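/- Let $D$ be a division ring, finite-dimensional over its center $C$, of prime characteristic $p$. Let $\delta$ be a derivation of $D$, $F=\{x\in C:\delta(x)=0\}$, and let $R=D[t;\delta]$ be the differential polynomial ring, with multiplication given by $ty=yt+\delta(y)$ for $y\in D$. Suppose that $\delta$ is algebraic of degree $p$ with minimum polynomial $g(x)=x^p-ax$, $a\in F$; that is, $g$ is the monic polynomial of least degree over $F$ for which $g(\delta)$ is an inner derivation. Let $c\in D$ satisfy $g(\delta)=\delta_c$, where $\delta_c(y)=cy-yc$, and $\delta(c)=0$ (so that $R$ has center $F[g(t)-c]$). Let $f\in R$ be monic of degree $m\ge 1$, and let $h(t)=\hat h(g(t)-c)$, with $\hat h\in F[x]$ monic, be its minimal central left multiple, i.e. the nonzero element of least degree in the center of $R$ that lies in $Rf$. Suppose that $\hat h$ is irreducible in $F[x]$. Call $f$ a generalised A-polynomial if its eigenring $\mathcal E(f)=\{q\in R: fq\in Rf\}/Rf$ is a (finite-dimensional) central simple algebra over $F$. For $\alpha\in D$ let $V_p(\alpha)\in D$ be given by $(t-\alpha)^p=t^p-V_p(\alpha)$, and for $v\in D^\times$ put $\Omega_v(\alpha)=v\alpha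 v^{-1}+\delta(v)v^{-1}$. Then $f$ is a generalised A-polynomial if and only if one of the following holds: (i) $f(t)=h(t)=t^p-at-(b+c)$ for some $b\in F$ such that $V_p(\alpha)-a\alpha-(b+c)\neq 0$ for all $\alpha\in D$; (ii) $h(t)=t^p-at-(b+c)$ for some $b\in F$, $m\le p$, and $f(t)=\prod_{i=1}^m\bigl(t-\Omega_{c_i}(\alpha)\bigr)$ (factors in the order $i=1,\dots,m$ from left to right) for some $\alpha\in D$ and $c_1,\dots,c_m\in D^\times$ with $c_m=1$ such that $V_p(\alpha)-a\alpha-(b+c)=0$. In case (i), $f$ is irreducible in $R$. -/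

import Mathlib

open Polynomial

/-- A derivation of a (not necessarily commutative) ring `D`: an additive map with
`δ (x y) = x δ(y) + δ(x) y`. -/
structure RingDer (D : Type*) [Ring D] extends D →+ D where
  leibniz' : ∀ x y : D, toFun (x * y) = x * toFun y + toFun x * y

namespace RingDer

instance {D : Type*} [Ring D] : FunLike (RingDer D) D D where
  coe δ := δ.toFun
  coe_injective := by
    rintro ⟨f, hf⟩ ⟨g, hg⟩ h
    have : f = g := DFunLike.coe_injective h
    subst this
    rfl

instance {D : Type*} [Ring D] : AddMonoidHomClass (RingDer D) D D where
  map_add δ := δ.map_add'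
  map_zero δ := δ.map_zero'

theorem leibniz {D : Type*} [Ring D] (δ : RingDer D) (x y : D) :
    δ (x * y) = x * δ y + δ x * y := δ.leibniz' x y

theorem map_one_eq_zero {D : Type*} [Ring D] (δ : RingDer D) : δ 1 = 0 := by
  have h := δ.leibniz 1 1
  simp only [mul_one, one_mul] at h
  exact left_eq_add.mp h

/-- The field `F = C ∩ Const(δ)`: the central elements of `D` that are killed by `δ`. -/
def centralConstants {D : Type*} [DivisionRing D] (δ : RingDer D) : Subfield D where
  carrier := {x | x ∈ Subring.center D ∧ δ x = 0}
  mul_mem' := by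
    rintro x y ⟨hx, hx'⟩ ⟨hy, hy'⟩
    exact ⟨mul_mem hx hy, by rw [leibniz, hx', hy']; simp⟩
  one_mem' := ⟨one_mem _, δ.map_one_eq_zero⟩
  add_mem' := by
    rintro x y ⟨hx, hx'⟩ ⟨hy, hy'⟩
    exact ⟨add_mem hx hy, by rw [map_add, hx', hy', add_zero]⟩
  zero_mem' := ⟨zero_mem _, map_zero δ⟩
  neg_mem' := by
    rintro x ⟨hx, hx'⟩
    exact ⟨neg_mem hx, by rw [map_neg, hx', neg_zero]⟩
  inv_mem' := by
    rintro x ⟨hx, hx'⟩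
    refine ⟨Set.inv_mem_center hx, ?_⟩
    by_cases h0 : x = 0
    · subst h0
      simp only [inv_zero]
      exact map_zero δ
    · have h := δ.leibniz x x⁻¹
      have hx2 : δ x = 0 := hx'
      rw [mul_inv_cancel₀ h0, δ.map_one_eq_zero, hx2, zero_mul, add_zero] at h
      exact (mul_eq_zero.mp h.symm).resolve_left h0

theorem commute_of_mem_centralConstants {D : Type*} [DivisionRing D] (δ : RingDer D)
    (a : δ.centralConstants) (x : D) : (a : D) * x = x * a :=
  ((Subring.mem_center_iff.mp a.2.1) x).symm

instance {D : Type*} [DivisionRing D] (δ : RingDer D) : Field δ.centralConstants :=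
  { (inferInstance : DivisionRing δ.centralConstants) with
    mul_comm := fun a b => Subtype.ext (δ.commute_of_mem_centralConstants a b) }

/-- The map `P(δ) : D → D` for a polynomial `P = ∑ rᵢ xⁱ` over `F`, i.e. `x ↦ ∑ rᵢ δⁱ(x)`. -/
noncomputable def polyApply {D : Type*} [DivisionRing D] (δ : RingDer D)
    (P : (δ.centralConstants)[X]) (x : D) : D :=
  P.sum fun i r => (r : D) * (δ^[i] x)

/-- `u : D → D` is the inner derivation `δ_c`, `x ↦ [c, x] = c x - x c`. -/
def IsInnerBy {D : Type*} [Ring D] (u : D → D) (c : D) : Prop :=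
  ∀ x, u x = c * x - x * c

/-- `g` is the minimum polynomial of `δ` over `F`, modulo inner derivations: the monic polynomial
of least degree over `F` for which `g(δ)` is an inner derivation. -/
structure IsMinimumPolynomial {D : Type*} [DivisionRing D] (δ : RingDer D)
    (g : (δ.centralConstants)[X]) : Prop where
  monic : g.Monic
  inner : ∃ c, IsInnerBy (δ.polyApply g) c
  minimal : ∀ P : (δ.centralConstants)[X], P ≠ 0 →
    (∃ e, IsInnerBy (δ.polyApply P) e) → g.degree ≤ P.degree

end RingDer

section Eigenring

variable (k : Type*) {R : Type*} [CommRing k] [Ring R] [Algebra k R]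

/-- The left idealiser `I(f) = {g : f g ∈ R f}` of an element `f` of a `k`-algebra `R`. -/
def leftIdealiser (f : R) : Subalgebra k R where
  carrier := {g | f * g ∈ Ideal.span {f}}
  mul_mem' := by
    intro g g' hg hg'
    obtain ⟨r, hr⟩ := Ideal.mem_span_singleton'.mp hg
    show f * (g * g') ∈ Ideal.span {f}
    rw [← mul_assoc, ← hr, mul_assoc]
    exact Ideal.mul_mem_left _ _ hg'
  add_mem' := by
    intro g g' hg hg'
    show f * (g + g') ∈ Ideal.span {f}
    rw [mul_add]
    exact add_mem hg hg'
  algebraMap_mem' := by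
    intro a
    show f * algebraMap k R a ∈ Ideal.span {f}
    rw [← Algebra.commutes]
    exact Ideal.mul_mem_left _ _ (Ideal.mem_span_singleton_self f)

/-- `R f`, as a left ideal of the left idealiser of `f`. -/
def eigenIdeal (f : R) : Ideal (leftIdealiser k f) :=
  (Ideal.span {f}).comap (leftIdealiser k f).val

/-- `R f` is two-sided in the left idealiser of `f`. -/
instance (f : R) : (eigenIdeal k f).IsTwoSided where
  mul_mem_of_left := by
    intro x y hx
    obtain ⟨r, hr⟩ := Ideal.mem_span_singleton'.mp (show (x : R) ∈ Ideal.span {f} from hx)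
    show (x : R) * (y : R) ∈ Ideal.span {f}
    rw [← hr, mul_assoc]
    exact Ideal.mul_mem_left _ _ y.2

/-- The eigenring `E(f) = I(f) / R f`, a `k`-algebra. -/
abbrev Eigenring (f : R) : Type _ := leftIdealiser k f ⧸ eigenIdeal k f

end Eigenring

/-- The differential polynomial ring `D[t; δ]`. As an additive group it consists of the
polynomials `∑ aᵢ tⁱ` with coefficients written on the left; the multiplication,
with `t a = a t + δ(a)`, is defined below. -/
structure DiffPoly {D : Type*} [Ring D] (δ : RingDer D) where
  /-- The element with given left coefficients. -/
  ofPoly ::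
  /-- The left coefficients. -/
  coeffs : D[X]

namespace DiffPoly

section Basic

variable {D : Type*} [Ring D] {δ : RingDer D}

variable (δ) in
/-- Passing to the polynomial of left coefficients. -/
def coeffsEquiv : DiffPoly δ ≃ D[X] where
  toFun := coeffs
  invFun := ofPoly
  left_inv _ := rfl
  right_inv _ := rfl

noncomputable instance : AddCommGroup (DiffPoly δ) := (coeffsEquiv δ).addCommGroup

/-- `coeffs` as an additive isomorphism. -/
noncomputable def toPoly : DiffPoly δ ≃+ D[X] := (coeffsEquiv δ).addEquiv

/-- The coefficient of `tⁱ`. -/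
noncomputable def coeff (f : DiffPoly δ) (i : ℕ) : D := (toPoly f).coeff i

/-- The degree, with value `0` at `0`. -/
noncomputable def natDegree (f : DiffPoly δ) : ℕ := (toPoly f).natDegree

/-- The degree, with value `⊥` at `0`. -/
noncomputable def degree (f : DiffPoly δ) : WithBot ℕ := (toPoly f).degree

/-- The leading coefficient is `1`. -/
def Monic (f : DiffPoly δ) : Prop := (toPoly f).Monic

variable (δ) in
/-- Left multiplication by `t`: `∑ bⱼ tʲ ↦ ∑ (bⱼ tʲ⁺¹ + δ(bⱼ) tʲ)`. -/
noncomputable def tMul : AddMonoid.End D[X] where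
  toFun g := g * X + g.sum fun j b => monomial j (δ b)
  map_zero' := by simp
  map_add' g g' := by
    rw [add_mul, Polynomial.sum_add_index _ _ _ (by simp) (by simp)]
    abel

/-- Left multiplication by the constant `a`: `∑ bⱼ tʲ ↦ ∑ a bⱼ tʲ`. -/
noncomputable def cMul (a : D) : AddMonoid.End D[X] := AddMonoidHom.mulLeft (Polynomial.C a)

theorem cMul_apply (a : D) (f : D[X]) : cMul a f = Polynomial.C a * f := rfl

theorem cMul_zero : cMul (0 : D) = 0 := by
  refine DFunLike.ext _ _ fun f => ?_
  rw [cMul_apply, map_zero, zero_mul]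
  rfl

theorem cMul_one : cMul (1 : D) = 1 := by
  refine DFunLike.ext _ _ fun f => ?_
  rw [cMul_apply, map_one, one_mul]
  rfl

theorem cMul_add (a b : D) : cMul (a + b) = cMul a + cMul b := by
  refine DFunLike.ext _ _ fun f => ?_
  rw [cMul_apply, map_add, add_mul]
  rfl

theorem cMul_mul (a b : D) : cMul (a * b) = cMul a * cMul b := by
  refine DFunLike.ext _ _ fun f => ?_
  rw [cMul_apply, map_mul, mul_assoc]
  rfl

variable (δ) in
/-- Left multiplication by `∑ aᵢ tⁱ`. -/
noncomputable def leftMul : D[X] →+ AddMonoid.End D[X] where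
  toFun f := f.sum fun i a => cMul a * tMul δ ^ i
  map_zero' := by simp
  map_add' f f' := by
    apply Polynomial.sum_add_index
    · intro i
      rw [cMul_zero, zero_mul]
    · intro i a b
      rw [cMul_add, add_mul]

noncomputable instance : Mul (DiffPoly δ) where
  mul f g := toPoly.symm (leftMul δ (toPoly f) (toPoly g))

noncomputable instance : One (DiffPoly δ) where
  one := toPoly.symm 1

theorem tMul_monomial (j : ℕ) (b : D) :
    tMul δ (monomial j b) = monomial (j + 1) b + monomial j (δ b) := by
  show monomial j b * X + (monomial j b).sum (fun j b => monomial j (δ b)) = _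
  rw [monomial_mul_X, Polynomial.sum_monomial_index _ _ (by simp)]

theorem cMul_monomial (a : D) (j : ℕ) (b : D) : cMul a (monomial j b) = monomial j (a * b) := by
  rw [cMul_apply, C_mul_monomial]

theorem leftMul_monomial (i : ℕ) (a : D) : leftMul δ (monomial i a) = cMul a * tMul δ ^ i := by
  show (monomial i a).sum (fun i a => cMul a * tMul δ ^ i) = _
  rw [Polynomial.sum_monomial_index _ _ (by rw [cMul_zero, zero_mul])]

theorem tMul_mul_cMul (a : D) : tMul δ * cMul a = cMul a * tMul δ + cMul (δ a) := by
  apply Polynomial.addHom_ext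
  intro j b
  show tMul δ (cMul a (monomial j b)) = cMul a (tMul δ (monomial j b)) + cMul (δ a) (monomial j b)
  rw [cMul_monomial, tMul_monomial, tMul_monomial, map_add, cMul_monomial, cMul_monomial,
    cMul_monomial, δ.leibniz, map_add, add_assoc]

theorem leftMul_tMul (g : D[X]) : leftMul δ (tMul δ g) = tMul δ * leftMul δ g := by
  induction g using Polynomial.induction_on' with
  | add p q hp hq => rw [map_add, map_add, map_add, hp, hq, mul_add]
  | monomial j b =>
    rw [tMul_monomial, map_add, leftMul_monomial, leftMul_monomial, leftMul_monomial, ← mul_assoc,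
      tMul_mul_cMul, add_mul, mul_assoc (cMul b), ← pow_succ']

theorem leftMul_cMul (a : D) (g : D[X]) : leftMul δ (cMul a g) = cMul a * leftMul δ g := by
  induction g using Polynomial.induction_on' with
  | add p q hp hq => rw [map_add, map_add, map_add, hp, hq, mul_add]
  | monomial j b =>
    rw [cMul_monomial, leftMul_monomial, leftMul_monomial, ← mul_assoc, cMul_mul]

theorem leftMul_add (f f' g : D[X]) :
    leftMul δ (f + f') g = leftMul δ f g + leftMul δ f' g := by
  rw [map_add]
  rfl

theorem leftMul_mul (f g : D[X]) :
    leftMul δ (leftMul δ f g) = leftMul δ f * leftMul δ g := by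
  induction f using Polynomial.induction_on' with
  | add p q hp hq =>
    rw [leftMul_add, map_add, hp, hq, map_add, add_mul]
  | monomial i a =>
    rw [leftMul_monomial]
    show leftMul δ (cMul a ((tMul δ ^ i) g)) = _
    rw [leftMul_cMul, mul_assoc]
    congr 1
    induction i with
    | zero => simp
    | succ i ih =>
      rw [pow_succ', mul_assoc, ← ih]
      exact leftMul_tMul _

theorem tMul_pow_one (i : ℕ) : (tMul δ ^ i) (1 : D[X]) = monomial i 1 := by
  induction i with
  | zero => simp
  | succ i ih =>
    rw [pow_succ']
    show tMul δ ((tMul δ ^ i) 1) = _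
    rw [ih, tMul_monomial, δ.map_one_eq_zero, map_zero, add_zero]

theorem leftMul_one_right (f : D[X]) : leftMul δ f 1 = f := by
  induction f using Polynomial.induction_on' with
  | add p q hp hq =>
    rw [map_add]
    exact congrArg₂ (· + ·) hp hq
  | monomial i a =>
    rw [leftMul_monomial]
    show cMul a ((tMul δ ^ i) 1) = _
    rw [tMul_pow_one, cMul_monomial, mul_one]

theorem leftMul_one : leftMul δ (1 : D[X]) = 1 := by
  rw [← monomial_zero_one, leftMul_monomial, pow_zero, mul_one, cMul_one]

theorem toPoly_mul (f g : DiffPoly δ) : toPoly (f * g) = leftMul δ (toPoly f) (toPoly g) :=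
  toPoly.apply_symm_apply _

theorem toPoly_one : toPoly (1 : DiffPoly δ) = 1 := toPoly.apply_symm_apply _

noncomputable instance : Ring (DiffPoly δ) :=
  { (inferInstance : AddCommGroup (DiffPoly δ)) with
    mul := (· * ·)
    one := 1
    left_distrib := fun f g h => toPoly.injective <| by
      simp only [toPoly_mul, map_add]
    right_distrib := fun f g h => toPoly.injective <| by
      rw [toPoly_mul, map_add, leftMul_add, map_add, toPoly_mul, toPoly_mul]
    zero_mul := fun f => toPoly.injective <| by
      rw [toPoly_mul, map_zero, map_zero]
      rfl
    mul_zero := fun f => toPoly.injective <| by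
      rw [toPoly_mul, map_zero, map_zero]
    mul_assoc := fun f g h => toPoly.injective <| by
      rw [toPoly_mul, toPoly_mul, toPoly_mul, toPoly_mul, leftMul_mul]
      rfl
    one_mul := fun f => toPoly.injective <| by
      rw [toPoly_mul, toPoly_one, leftMul_one]
      rfl
    mul_one := fun f => toPoly.injective <| by
      rw [toPoly_mul, toPoly_one, leftMul_one_right] }

variable (δ) in
/-- The constants, as a ring homomorphism `D → D[t; δ]`. -/
noncomputable def const : D →+* DiffPoly δ where
  toFun a := ofPoly (Polynomial.C a)
  map_one' := rfl
  map_zero' := toPoly.injective (map_zero Polynomial.C)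
  map_add' a b := toPoly.injective (map_add Polynomial.C a b)
  map_mul' a b := toPoly.injective <| by
    rw [toPoly_mul]
    show monomial 0 (a * b) = leftMul δ (monomial 0 a) (monomial 0 b)
    rw [leftMul_monomial, pow_zero, mul_one, cMul_monomial]

variable (δ) in
/-- The indeterminate `t`. -/
noncomputable def t : DiffPoly δ := ofPoly Polynomial.X

theorem toPoly_const (a : D) : toPoly (const δ a) = monomial 0 a := rfl

theorem toPoly_t : toPoly (t δ) = monomial 1 1 := rfl

/-- The defining relation `t a = a t + δ(a)`. -/
theorem t_mul_const (a : D) : t δ * const δ a = const δ a * t δ + const δ (δ a) := by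
  apply toPoly.injective
  rw [map_add, toPoly_mul, toPoly_mul, toPoly_t, toPoly_const, toPoly_const, leftMul_monomial,
    leftMul_monomial, cMul_one, one_mul, pow_one, pow_zero, mul_one, tMul_monomial, cMul_monomial,
    mul_one]

/-- `a tⁱ` is the polynomial whose only coefficient is `a`, in degree `i`. -/
theorem toPoly_const_mul_t_pow (a : D) (i : ℕ) : toPoly (const δ a * t δ ^ i) = monomial i a := by
  have h : ∀ i : ℕ, toPoly (t δ ^ i) = monomial i 1 := by
    intro i
    induction i with
    | zero => rfl
    | succ i ih =>
      rw [pow_succ', toPoly_mul, ih, toPoly_t, leftMul_monomial, cMul_one, one_mul, pow_one,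
        tMul_monomial, δ.map_one_eq_zero, map_zero, add_zero]
  rw [toPoly_mul, h, toPoly_const, leftMul_monomial, pow_zero, mul_one, cMul_monomial, mul_one]

/-- Every element is `∑ aᵢ tⁱ`. -/
theorem eq_sum (f : DiffPoly δ) :
    f = ∑ i ∈ (toPoly f).support, const δ (coeff f i) * t δ ^ i := by
  apply toPoly.injective
  rw [map_sum]
  simp only [toPoly_const_mul_t_pow]
  exact (toPoly f).as_sum_support

end Basic

section DivisionRing

variable {D : Type*} [DivisionRing D] {δ : RingDer D}

theorem const_mul_comm (a : δ.centralConstants) (f : DiffPoly δ) :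
    const δ a * f = f * const δ a := by
  have hd : δ (a : D) = 0 := a.2.2
  have ht : Commute (const δ (a : D)) (t δ) := by
    show _ = _
    rw [t_mul_const, hd, map_zero, add_zero]
  rw [f.eq_sum]
  refine Commute.sum_right _ _ _ fun i _ => Commute.mul_right ?_ (ht.pow_right i)
  show _ = _
  rw [← map_mul, ← map_mul, δ.commute_of_mem_centralConstants]

/-- `D[t; δ]` is an algebra over `F`, through the constants. -/
noncomputable instance : Algebra δ.centralConstants (DiffPoly δ) :=
  ((const δ).comp δ.centralConstants.subtype).toAlgebra' fun a f => const_mul_comm a f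

/-- `f` is a generalised A-polynomial: its eigenring is a central simple algebra over `F`. -/
structure IsGeneralisedAPolynomial (f : DiffPoly δ) : Prop where
  isSimple : IsSimpleRing (Eigenring δ.centralConstants f)
  isCentral : Algebra.IsCentral δ.centralConstants (Eigenring δ.centralConstants f)
  finite : Module.Finite δ.centralConstants (Eigenring δ.centralConstants f)

/-- Given `z` in `R = D[t; δ]` (the generator of the centre `F[z]` of `R`), `h` is the minimal
central left multiple of `f` in `R`, written as `h = ĥ(z)` with `ĥ ∈ F[x]` monic. -/
structure IsMinimalCentralLeftMultiple (z f h : DiffPoly δ) (hhat : (δ.centralConstants)[X]) :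
    Prop where
  monic : hhat.Monic
  eq_aeval : h = aeval z hhat
  mem_center : h ∈ Subring.center (DiffPoly δ)
  left_multiple : ∃ q, h = q * f
  minimal : ∀ k ∈ Subring.center (DiffPoly δ), k ≠ 0 → (∃ q, k = q * f) → h.degree ≤ k.degree

variable (δ) in
/-- `V_p(b)`, defined through `(t - b)ᵖ = tᵖ - V_p(b)` in `D[t; δ]` for `D` of prime
characteristic `p`, i.e. `V_p(b) = bᵖ + δᵖ⁻¹(b) + ∇_b` with `∇_b` a sum of commutators: the
constant `tᵖ - (t - b)ᵖ`. -/
noncomputable def V (p : ℕ) (b : D) : D := coeff (t δ ^ p - (t δ - const δ b) ^ p) 0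

variable (δ) in
/-- `Ω_v(α) = v α v⁻¹ + δ(v) v⁻¹`. -/
def Omega (v α : D) : D := v * α * v⁻¹ + δ v * v⁻¹

end DivisionRing

end DiffPoly

/-!
Put `z = g(t) - c`. For every `b` in `F` the element `z - b` is central of degree `p`, and since `g`
is the minimum polynomial of `δ`, the only central elements of smaller degree are those of `F`;
hence `R / R(z - b)` is a central simple `F`-algebra. It is finite-dimensional because `[D : F]` is
finite, by descent from relations among the jets `(y, δ y, …, δ^(p-1) y)`. If `z - b ∈ R f`, then
`R f` is the preimage of the left annihilator of an idempotent `e` of this algebra, so `E(f)` is the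
corner at `e` and `f` is a generalised A-polynomial. Conversely, if `E(f)` has centre `F`, then
`z - b ∈ R f` for some `b` in `F`, so `ĥ(b) ∈ R f`, whence `ĥ(b) = 0` and `ĥ = x - b`.

The degree of any right factor of `h = z - b` is a multiple of the least positive one, because
`R / R h` is simple and therefore every factor has a right factor `g` with `R / R g` embedded in a
given `R / R f₀`. As `p` is prime, either `h` is irreducible and `f = h`, or `h` has a right factor
`t - α`. In the latter case every nonconstant factor of `h` has a right factor `t - Ω_v(α)`, and so
`f` is a product of these.
-/

section CharP

theorem mulLeft_sub_mulRight_pow_char {S : Type*} [Ring S] (p : ℕ) [Fact p.Prime] [CharP S p]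
    (x y : S) :
    (LinearMap.mulLeft ℤ x - LinearMap.mulRight ℤ y) ^ p =
      LinearMap.mulLeft ℤ (x ^ p) - LinearMap.mulRight ℤ (y ^ p) := by
  have : CharP (Module.End ℤ S) p :=
    charP_of_injective_ringHom (f := (Algebra.lmul ℤ S).toRingHom) Algebra.lmul_injective p
  rw [sub_pow_char_of_commute p (LinearMap.commute_mulLeft_right x y), LinearMap.pow_mulLeft,
    LinearMap.pow_mulRight]

end CharP

section Corner

variable {A : Type*} [Ring A] {e : A}

/-- The compression `x ↦ e x e` of a ring onto its corner at the idempotent `e`. -/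
def compress (he : IsIdempotentElem e) : A →+ he.Corner where
  toFun x := ⟨e * x * e, x, rfl⟩
  map_zero' := Subtype.ext (by simp only [mul_zero, zero_mul]; rfl)
  map_add' x y := Subtype.ext <|
    (congrArg (· * e) (mul_add e x y)).trans (add_mul (e * x) (e * y) e)

theorem coe_compress (he : IsIdempotentElem e) (x : A) : (compress he x).1 = e * x * e := rfl

theorem compress_mul_compress (he : IsIdempotentElem e) (x y : A) :
    compress he x * compress he y = compress he (x * e * y) :=
  Subtype.ext <| by
    change e * x * e * (e * y * e) = e * (x * e * y) * e
    simp only [mul_assoc, he.mul_self_mul]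

theorem compress_coe (he : IsIdempotentElem e) (z : he.Corner) : compress he z.1 = z := by
  obtain ⟨_, w, rfl⟩ := z
  exact Subtype.ext <| by simp only [coe_compress, mul_assoc, he.mul_self_mul, he.eq]

theorem compress_one (he : IsIdempotentElem e) : compress he 1 = 1 :=
  Subtype.ext <| by
    change e * 1 * e = e
    rw [mul_one, he.eq]

theorem compress_mul_coe_mul (he : IsIdempotentElem e) (x y : A) (z : he.Corner) :
    compress he (x * z.1 * y) = compress he x * z * compress he y := by
  obtain ⟨_, w, rfl⟩ := z
  change _ = compress he x * compress he w * compress he y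
  rw [compress_mul_compress, compress_mul_compress]
  simp only [mul_assoc]

theorem compress_mul_compress_of_commute_left (he : IsIdempotentElem e) {x : A} (hx : Commute x e)
    (y : A) : compress he x * compress he y = compress he (x * y) := by
  rw [compress_mul_compress]
  exact Subtype.ext <| by simp only [coe_compress, mul_assoc, hx.left_comm, he.mul_self_mul]

theorem compress_mul_compress_of_commute_right (he : IsIdempotentElem e) (x : A) {y : A}
    (hy : Commute y e) : compress he x * compress he y = compress he (x * y) := by
  rw [compress_mul_compress]
  exact Subtype.ext <| by simp only [coe_compress, mul_assoc, ← hy.eq, he.eq]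

section Algebra

variable {k : Type*} [CommRing k] [Algebra k A]

/-- The algebra structure on a corner `e A e`, with structure map `r ↦ r e`. -/
instance cornerAlgebra (he : IsIdempotentElem e) : Algebra k he.Corner :=
  RingHom.toAlgebra'
    { toFun r := compress he (algebraMap k A r)
      map_one' := by rw [map_one, compress_one]
      map_zero' := by rw [map_zero, map_zero]
      map_add' r s := by rw [map_add, map_add]
      map_mul' r s := by
        rw [compress_mul_compress_of_commute_left he (Algebra.commutes r e), map_mul] }
    fun r z => by
      change compress he (algebraMap k A r) * z = z * compress he (algebraMap k A r)
      rw [← compress_coe he z, compress_mul_compress_of_commute_left he (Algebra.commutes r e),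
        compress_mul_compress_of_commute_right he _ (Algebra.commutes r e), Algebra.commutes]

theorem compress_smul (he : IsIdempotentElem e) (r : k) (x : A) :
    compress he (r • x) = r • compress he x := by
  rw [Algebra.smul_def, ← compress_mul_compress_of_commute_left he (Algebra.commutes r e)]
  rfl

instance finite_corner (he : IsIdempotentElem e) [Module.Finite k A] :
    Module.Finite k he.Corner :=
  Module.Finite.of_surjective ({ compress he with map_smul' := compress_smul he } : A →ₗ[k] _)
    fun z => ⟨z.1, compress_coe he z⟩

end Algebra

variable [IsSimpleRing A]

theorem isSimpleRing_corner (he : IsIdempotentElem e) (he0 : e ≠ 0) : IsSimpleRing he.Corner := by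
  have : Nontrivial he.Corner := ⟨1, 0, fun h => he0 (congrArg Subtype.val h)⟩
  refine IsSimpleRing.of_eq_bot_or_eq_top fun I => or_iff_not_imp_left.mpr fun hI => ?_
  obtain ⟨x, hxI, hx0⟩ := SetLike.exists_of_lt (bot_lt_iff_ne_bot.mpr hI)
  let J : TwoSidedIdeal A := TwoSidedIdeal.mk' {y | ∀ c d, compress he (c * y * d) ∈ I}
    (fun c d => by simp only [mul_zero, zero_mul, map_zero, I.zero_mem])
    (fun hy hy' c d => by
      rw [mul_add, add_mul, map_add]
      exact I.add_mem (hy c d) (hy' c d))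
    (fun hy c d => by
      rw [mul_neg, neg_mul, map_neg]
      exact I.neg_mem (hy c d))
    (fun {y z} hz c d => by
      rw [← mul_assoc]
      exact hz (c * y) d)
    (fun {y z} hy c d => by
      rw [← mul_assoc c, mul_assoc]
      exact hy c (z * d))
  have hxJ : x.1 ∈ J := (TwoSidedIdeal.mem_mk' ..).mpr fun c d => by
    rw [compress_mul_coe_mul]
    exact I.mul_mem_right _ _ (I.mul_mem_left _ _ hxI)
  have h1 := (TwoSidedIdeal.mem_mk' ..).mp
    (IsSimpleRing.one_mem_of_ne_zero_mem J (fun h => hx0 (Subtype.ext h)) hxJ) 1 1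
  rw [mul_one, mul_one, compress_one] at h1
  exact I.one_mem_iff.mp h1

theorem eq_zero_of_forall_compress_eq_zero (he : IsIdempotentElem e) (he0 : e ≠ 0) {y : A}
    (hy : ∀ c d, compress he (c * y * d) = 0) : y = 0 := by
  let J : TwoSidedIdeal A := TwoSidedIdeal.mk' {y | ∀ c d, compress he (c * y * d) = 0}
    (fun c d => by rw [mul_zero, zero_mul, map_zero])
    (fun hy hy' c d => by rw [mul_add, add_mul, map_add, hy, hy', add_zero])
    (fun hy c d => by rw [mul_neg, neg_mul, map_neg, hy, neg_zero])
    (fun {y z} hz c d => by rw [← mul_assoc, hz])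
    (fun {y z} hy c d => by rw [← mul_assoc c, mul_assoc, hy])
  by_contra hy0
  have h1 := (TwoSidedIdeal.mem_mk' ..).mp
    (IsSimpleRing.one_mem_of_ne_zero_mem J hy0 ((TwoSidedIdeal.mem_mk' ..).mpr hy)) 1 1
  rw [mul_one, mul_one, compress_one] at h1
  exact he0 (congrArg Subtype.val h1)

theorem exists_forall_compress_eq_mul (he : IsIdempotentElem e) (he0 : e ≠ 0) {z : he.Corner}
    (hz : ∀ w, w * z = z * w) :
    ∃ y : A, ∀ c d, compress he (c * y * d) = z * compress he (c * d) := by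
  let J : TwoSidedIdeal A := TwoSidedIdeal.mk'
    {x | ∃ y, ∀ c d, compress he (c * y * d) = z * compress he (c * x * d)}
    ⟨0, fun c d => by simp only [mul_zero, zero_mul, map_zero]⟩
    (fun ⟨y, hy⟩ ⟨y', hy'⟩ =>
      ⟨y + y', fun c d => by simp only [mul_add, add_mul, map_add, hy, hy']⟩)
    (fun ⟨y, hy⟩ => ⟨-y, fun c d => by
      rw [mul_neg, neg_mul, map_neg, hy, mul_neg, neg_mul, map_neg]
      exact (mul_neg z _).symm⟩)
    (fun {r x} ⟨y, hy⟩ => ⟨r * y, fun c d => by simp only [← mul_assoc, hy]⟩)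
    (fun {x r} ⟨y, hy⟩ => ⟨y * r, fun c d => by
      rw [← mul_assoc c, mul_assoc, hy, ← mul_assoc c, mul_assoc (c * x)]⟩)
  have heJ : e ∈ J := (TwoSidedIdeal.mem_mk' ..).mpr ⟨z.1, fun c d => by
    rw [compress_mul_coe_mul, hz, mul_assoc, compress_mul_compress]⟩
  obtain ⟨y, hy⟩ := (TwoSidedIdeal.mem_mk' ..).mp (IsSimpleRing.one_mem_of_ne_zero_mem J he0 heJ)
  exact ⟨y, fun c d => by rw [hy, mul_one]⟩

theorem isCentral_corner (k : Type*) [CommRing k] [Algebra k A] [Algebra.IsCentral k A]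
    (he : IsIdempotentElem e) (he0 : e ≠ 0) : Algebra.IsCentral k he.Corner where
  out z hz := by
    obtain ⟨y, hy⟩ := exists_forall_compress_eq_mul he he0 (Subalgebra.mem_center_iff.mp hz)
    have hyc : y ∈ Subalgebra.center k A := Subalgebra.mem_center_iff.mpr fun a =>
      sub_eq_zero.mp <| eq_zero_of_forall_compress_eq_zero he he0 fun c d => by
        rw [mul_sub, sub_mul, map_sub, ← mul_assoc, hy, ← mul_assoc c, mul_assoc (c * y), hy,
          mul_assoc, sub_self]
    obtain ⟨b, rfl⟩ := (Algebra.IsCentral.mem_center_iff k).mp hyc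
    refine ⟨b, ?_⟩
    have h1 := hy 1 1
    rw [mul_one, mul_one, one_mul, compress_one, mul_one] at h1
    exact h1

end Corner

section Eigenring

variable {k R A : Type*} [CommRing k] [Ring R] [Algebra k R] [Ring A] [Algebra k A]

theorem mul_mul_self_eq_mul_of_mem_leftIdealiser {π : R →ₐ[k] A} (hπ : Function.Surjective π)
    {e : A} (he : IsIdempotentElem e) {f : R} (hf : ∀ x, π x * e = 0 ↔ x ∈ Ideal.span {f})
    {q : R} (hq : q ∈ leftIdealiser k f) : e * π q * e = π q * e := by
  obtain ⟨x, hx⟩ := hπ (1 - e)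
  have hxf : x ∈ Ideal.span {f} := (hf x).mp (by rw [hx, he.one_sub_mul_self])
  obtain ⟨r, rfl⟩ := Ideal.mem_span_singleton'.mp hxf
  have h0 : (1 - e) * π q * e = 0 := by
    rw [← hx, ← map_mul, hf, mul_assoc]
    exact Ideal.mul_mem_left _ r hq
  rwa [sub_mul, sub_mul, one_mul, sub_eq_zero, eq_comm] at h0

/-- If the left ideal `R f` is the preimage of the left annihilator of an idempotent `e` of a
quotient `A` of `R`, then `q ↦ π(q) e` identifies the eigenring of `f` with the corner `e A e`. -/
noncomputable def eigenringEquivCorner {π : R →ₐ[k] A} (hπ : Function.Surjective π)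
    {e : A} (he : IsIdempotentElem e) {f : R} (hf : ∀ x, π x * e = 0 ↔ x ∈ Ideal.span {f}) :
    Eigenring k f ≃ₐ[k] he.Corner :=
  let φ : leftIdealiser k f →ₐ[k] he.Corner :=
    { toFun q := compress he (π q)
      map_one' := by rw [OneMemClass.coe_one, map_one, compress_one]
      map_zero' := by rw [ZeroMemClass.coe_zero, map_zero, map_zero]
      map_add' q q' := by rw [Subalgebra.coe_add, map_add, map_add]
      map_mul' q q' := by
        have h := mul_mul_self_eq_mul_of_mem_leftIdealiser hπ he hf q'.2
        rw [compress_mul_compress, Subalgebra.coe_mul, map_mul]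
        exact Subtype.ext (by simp only [coe_compress, mul_assoc] at h ⊢; rw [h])
      commutes' r := congrArg (compress he) (π.commutes r) }
  have hφ : Function.Surjective φ := fun z => by
    obtain ⟨q, hq⟩ := hπ z.1
    have hfe : π f * e = 0 := (hf f).mpr (Ideal.mem_span_singleton_self f)
    have hqf : f * q ∈ Ideal.span {f} := by
      rw [← hf, map_mul, hq, ← congrArg Subtype.val (compress_coe he z), coe_compress]
      simp only [← mul_assoc, hfe, zero_mul]
    refine ⟨⟨q, hqf⟩, ?_⟩
    change compress he (π q) = z
    rw [hq, compress_coe]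
  have hker : eigenIdeal k f = RingHom.ker φ := Ideal.ext fun q => by
    change q.1 ∈ Ideal.span {f} ↔ compress he (π q) = 0
    rw [← hf, ← mul_mul_self_eq_mul_of_mem_leftIdealiser hπ he hf q.2]
    exact ⟨fun h => Subtype.ext h, congrArg Subtype.val⟩
  (Ideal.quotientEquivAlgOfEq k hker).trans (Ideal.quotientKerAlgEquivOfSurjective hφ)

theorem exists_isIdempotentElem_mul_eq_zero_iff [IsSemisimpleRing A] {π : R →ₐ[k] A}
    (hπ : Function.Surjective π) {f : R} (hker : RingHom.ker π ≤ Ideal.span {f}) :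
    ∃ e : A, IsIdempotentElem e ∧ ∀ x, π x * e = 0 ↔ x ∈ Ideal.span {f} := by
  obtain ⟨e, he, hspan⟩ := IsSemisimpleRing.ideal_eq_span_idempotent (Ideal.span {π f})
  have hmem (y : A) : y * (1 - e) = 0 ↔ y ∈ Ideal.span {π f} := by
    rw [hspan, mul_sub, mul_one, sub_eq_zero, Ideal.mem_span_singleton']
    constructor
    · exact fun h => ⟨y, h.symm⟩
    · rintro ⟨a, rfl⟩
      rw [mul_assoc, he.eq]
  refine ⟨1 - e, he.one_sub, fun x => (hmem _).trans ?_⟩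
  have hmap := Ideal.comap_map_of_surjective π hπ (Ideal.span {f})
  rw [Ideal.map_span, Set.image_singleton] at hmap
  have hker' : Ideal.comap π ⊥ ≤ Ideal.span {f} := hker
  rw [← Ideal.mem_comap, hmap, sup_eq_left.mpr hker']

theorem isCentralSimple_eigenring [IsArtinianRing k] {I : Ideal R} [I.IsTwoSided]
    [IsSimpleRing (R ⧸ I)] [Algebra.IsCentral k (R ⧸ I)] (hfin : Module.Finite k (R ⧸ I)) {f : R}
    (hIf : I ≤ Ideal.span {f}) (hf : (1 : R) ∉ Ideal.span {f}) :
    IsSimpleRing (Eigenring k f) ∧ Algebra.IsCentral k (Eigenring k f) ∧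
      Module.Finite k (Eigenring k f) := by
  have := IsArtinianRing.of_finite k (R ⧸ I)
  have := IsSimpleRing.isSemisimpleRing_iff_isArtinianRing.mpr this
  have hmk : Function.Surjective (Ideal.Quotient.mkₐ k I) := Ideal.Quotient.mk_surjective
  obtain ⟨e, he, hfe⟩ := exists_isIdempotentElem_mul_eq_zero_iff hmk
    ((Ideal.Quotient.mkₐ_ker k I).trans_le hIf)
  have he0 : e ≠ 0 := fun h => hf ((hfe 1).mp (by rw [h, mul_zero]))
  have := isSimpleRing_corner he he0
  have := isCentral_corner k he he0
  let φ := (eigenringEquivCorner hmk he hfe).symm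
  exact ⟨⟨φ.toRingEquiv.mapTwoSidedIdeal.symm.isSimpleOrder⟩, .of_algEquiv k _ _ φ,
    .equiv φ.toLinearEquiv⟩

end Eigenring

section Descent

variable {D ι : Type*} [DivisionRing D] [Finite ι]

-- A vector of minimal support, scaled to have an entry `1`, is killed by every `T`.
theorem exists_mem_ne_zero_forall_apply_eq_zero {W : Submodule D (ι → D)} (hW : W ≠ ⊥)
    {𝒯 : Set (D → D)} (h0 : ∀ T ∈ 𝒯, T 0 = 0) (h1 : ∀ T ∈ 𝒯, T 1 = 0)
    (hT : ∀ T ∈ 𝒯, ∀ w ∈ W, T ∘ w ∈ W) :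
    ∃ w ∈ W, w ≠ 0 ∧ ∀ T ∈ 𝒯, ∀ i, T (w i) = 0 := by
  obtain ⟨w, ⟨hwW, hw0⟩, hmin⟩ := WellFounded.has_min
    (InvImage.wf (fun w : ι → D => w.support.ncard) wellFounded_lt) {w | w ∈ W ∧ w ≠ 0}
    ((Submodule.ne_bot_iff W).mp hW)
  obtain ⟨i, hi⟩ := Function.ne_iff.mp hw0
  refine ⟨(w i)⁻¹ • w, W.smul_mem _ hwW, smul_ne_zero (inv_ne_zero hi) hw0, fun T hTT => ?_⟩
  suffices h : T ∘ ((w i)⁻¹ • w) = 0 from congrFun h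
  by_contra hne
  refine hmin _ ⟨hT T hTT _ (W.smul_mem _ hwW), hne⟩ (Set.ncard_lt_ncard ⟨fun j hj hwj => ?_, ?_⟩)
  · exact hj (by rw [Function.comp_apply, Pi.smul_apply, hwj, smul_zero, h0 T hTT])
  · exact fun h => h hi (by
      rw [Function.comp_apply, Pi.smul_apply, smul_eq_mul, inv_mul_cancel₀ hi, h1 T hTT])

end Descent

namespace RingDer

section JetRelations

variable {D ι : Type*} [Ring D] [Fintype ι] {δ : RingDer D} {n : ℕ} {y w : ι → D}

variable (δ) in
/-- The left linear relations `∑ wᵢ d δʲ(yᵢ) = 0`, imposed for all `d` in `D` and all `j < n`,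
between the jets of a finite family `y`. Descent turns a nonzero relation into one over `F`. -/
def jetRelations (n : ℕ) (y : ι → D) : Submodule D (ι → D) :=
  ⨅ (j : Fin n) (d : D), LinearMap.ker (Fintype.linearCombination D fun i => d * δ^[j] (y i))

theorem mem_jetRelations :
    w ∈ δ.jetRelations n y ↔ ∀ j < n, ∀ d, ∑ i, w i * (d * δ^[j] (y i)) = 0 := by
  simp only [jetRelations, Submodule.mem_iInf, LinearMap.mem_ker,
    Fintype.linearCombination_apply, smul_eq_mul]
  exact ⟨fun h j hj => h ⟨j, hj⟩, fun h j => h j j.2⟩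

theorem sum_mul_iterate_succ_eq_zero {k : ℕ} (hk : k < n) {a c : D}
    (hδ : ∀ x, δ^[n] x = a * δ^[k] x + (c * x - x * c)) (hw : w ∈ δ.jetRelations n y)
    {j : ℕ} (hj : j < n) (d : D) : ∑ i, w i * (d * δ^[j + 1] (y i)) = 0 := by
  rw [mem_jetRelations] at hw
  rcases (Nat.succ_le_of_lt hj).lt_or_eq with h | rfl
  · exact hw _ h d
  · have ha := hw k hk (d * a)
    have hc := hw 0 hj.pos (d * c)
    have hy := congrArg (· * c) (hw 0 hj.pos d)
    simp only [Finset.sum_mul, mul_assoc, zero_mul, Function.iterate_zero, id_eq] at ha hc hy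
    simp only [hδ, mul_add, mul_sub, Finset.sum_add_distrib, Finset.sum_sub_distrib, ha, hc, hy,
      sub_zero, add_zero]

theorem comp_mem_jetRelations {k : ℕ} (hk : k < n) {a c : D}
    (hδ : ∀ x, δ^[n] x = a * δ^[k] x + (c * x - x * c)) (hw : w ∈ δ.jetRelations n y) :
    δ ∘ w ∈ δ.jetRelations n y := by
  refine mem_jetRelations.mpr fun j hj d => ?_
  have h := congrArg δ (mem_jetRelations.mp hw j hj d)
  simp only [map_sum, leibniz, mul_add, Finset.sum_add_distrib, map_zero,
    ← Function.iterate_succ_apply'] at h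
  rwa [sum_mul_iterate_succ_eq_zero hk hδ hw hj, mem_jetRelations.mp hw j hj, zero_add,
    zero_add] at h

theorem commutator_comp_mem_jetRelations (e : D) (hw : w ∈ δ.jetRelations n y) :
    (fun x => e * x - x * e) ∘ w ∈ δ.jetRelations n y := by
  refine mem_jetRelations.mpr fun j hj d => ?_
  have h1 := congrArg (e * ·) (mem_jetRelations.mp hw j hj d)
  have h2 := mem_jetRelations.mp hw j hj (e * d)
  simp only [Finset.mul_sum, mul_zero, mul_assoc] at h1 h2
  simp only [Function.comp_apply, sub_mul, mul_assoc, Finset.sum_sub_distrib, h1, h2, sub_zero]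

end JetRelations

variable {D ι : Type*} [DivisionRing D] [Fintype ι] {δ : RingDer D} {n : ℕ}

theorem jetRelations_ne_bot (y : ι → D) {S : Finset D}
    (hS : Submodule.span (Subring.center D) (S : Set D) = ⊤) (hι : n * S.card < Fintype.card ι) :
    δ.jetRelations n y ≠ ⊥ := by
  let Φ : (ι → D) →ₗ[D] Fin n × S → D :=
    LinearMap.pi fun s => Fintype.linearCombination D fun i => s.2 * δ^[s.1] (y i)
  have hΦ : LinearMap.ker Φ ≠ ⊥ := LinearMap.ker_ne_bot_of_finrank_lt (by simpa using hι)
  refine fun hbot => hΦ (eq_bot_iff.mpr (le_trans (fun w hw => ?_) hbot.le))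
  refine mem_jetRelations.mpr fun j hj d => ?_
  have hd : d ∈ Submodule.span (Subring.center D) (S : Set D) := hS ▸ Submodule.mem_top
  induction hd using Submodule.span_induction with
  | mem d hd => exact congrFun hw (⟨j, hj⟩, ⟨d, hd⟩)
  | zero => simp only [zero_mul, mul_zero, Finset.sum_const_zero]
  | add d e _ _ hd he => simp only [add_mul, mul_add, Finset.sum_add_distrib, hd, he, add_zero]
  | smul r d _ hd =>
    have hr (x : D) : x * r = r * x := Subring.mem_center_iff.mp r.2 x
    simp only [Subring.smul_def, smul_eq_mul, ← mul_assoc, hr] at hd ⊢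
    simp only [mul_assoc, ← Finset.mul_sum] at hd ⊢
    rw [hd, mul_zero]

theorem finite_centralConstants [Module.Finite (Subring.center D) D] {k : ℕ} (hk : k < n)
    {a c : D} (hδ : ∀ x, δ^[n] x = a * δ^[k] x + (c * x - x * c)) :
    Module.Finite δ.centralConstants D := by
  obtain ⟨S, hS⟩ := Module.finite_def.mp ‹Module.Finite (Subring.center D) D›
  suffices h : Module.rank δ.centralConstants D ≤ (n * S.card : ℕ) from
    Module.rank_lt_aleph0_iff.mp (h.trans_lt Cardinal.natCast_lt_aleph0)
  refine rank_le fun s hs => le_of_not_gt fun hcard => ?_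
  obtain ⟨w, hw, hw0, hconst⟩ := exists_mem_ne_zero_forall_apply_eq_zero
    (jetRelations_ne_bot (δ := δ) ((↑) : s → D) hS (by simpa using hcard))
    (𝒯 := insert (δ : D → D) (Set.range fun e x => e * x - x * e))
    (by rintro _ (rfl | ⟨e, rfl⟩) <;> simp)
    (by rintro _ (rfl | ⟨e, rfl⟩) <;> simp [map_one_eq_zero])
    (by
      rintro _ (rfl | ⟨e, rfl⟩) w hw
      exacts [comp_mem_jetRelations hk hδ hw, commutator_comp_mem_jetRelations e hw])
  let w' (i : s) : δ.centralConstants := ⟨w i, Subring.mem_center_iff.mpr fun e =>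
    sub_eq_zero.mp (hconst _ (Or.inr ⟨e, rfl⟩) i), hconst _ (Or.inl rfl) i⟩
  have hsum : ∑ i, w' i • (i : D) = 0 :=
    (Finset.sum_congr rfl fun i _ => by rw [one_mul]; rfl).trans
      (mem_jetRelations.mp hw 0 hk.pos 1)
  exact hw0 (funext fun i =>
    congrArg Subtype.val (Fintype.linearIndependent_iff.mp hs w' hsum i))

end RingDer

namespace DiffPoly

section Ring

variable {D : Type*} [Ring D] {δ : RingDer D}

theorem coeff_tMul_zero (g : D[X]) : (tMul δ g).coeff 0 = δ (g.coeff 0) := by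
  induction g using Polynomial.induction_on' with
  | add f g hf hg => simp only [map_add, Polynomial.coeff_add, hf, hg]
  | monomial j b =>
    rw [tMul_monomial, Polynomial.coeff_add, coeff_monomial_succ, zero_add, coeff_monomial,
      coeff_monomial, apply_ite δ, map_zero]

theorem coeff_tMul_succ (g : D[X]) (n : ℕ) :
    (tMul δ g).coeff (n + 1) = g.coeff n + δ (g.coeff (n + 1)) := by
  induction g using Polynomial.induction_on' with
  | add f g hf hg => simp only [map_add, Polynomial.coeff_add, hf, hg, add_add_add_comm]
  | monomial j b =>
    simp only [tMul_monomial, Polynomial.coeff_add, coeff_monomial, Nat.add_right_cancel_iff,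
      apply_ite δ, map_zero]

theorem coeff_tMul_pow_eq_zero {g : D[X]} {N : ℕ} (hg : g.natDegree ≤ N) (i : ℕ) {n : ℕ}
    (hn : i + N < n) : ((tMul δ ^ i) g).coeff n = 0 := by
  induction i generalizing n with
  | zero => exact coeff_eq_zero_of_natDegree_lt (by simpa using hg.trans_lt (by omega))
  | succ i ih =>
    obtain ⟨n, rfl⟩ : ∃ k, n = k + 1 := ⟨n - 1, by omega⟩
    rw [pow_succ', AddMonoid.End.coe_mul, Function.comp_apply, coeff_tMul_succ, ih (by omega),
      ih (by omega), map_zero, add_zero]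

theorem coeff_tMul_pow_add {g : D[X]} {N : ℕ} (hg : g.natDegree ≤ N) (i : ℕ) :
    ((tMul δ ^ i) g).coeff (i + N) = g.coeff N := by
  induction i with
  | zero => rw [pow_zero, AddMonoid.End.one_apply, zero_add]
  | succ i ih =>
    rw [pow_succ', AddMonoid.End.coe_mul, Function.comp_apply, add_right_comm, coeff_tMul_succ, ih,
      coeff_tMul_pow_eq_zero hg _ (Nat.lt_succ_self _), map_zero, add_zero]

theorem coeff_tMul_pow_C_self (y : D) (i : ℕ) :
    ((tMul δ ^ i) (Polynomial.C y)).coeff i = y := by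
  simpa using coeff_tMul_pow_add (δ := δ) (natDegree_C y).le i

theorem coeff_tMul_pow_succ_C (y : D) (i : ℕ) :
    ((tMul δ ^ (i + 1)) (Polynomial.C y)).coeff i = (i + 1 : ℕ) * δ y := by
  induction i with
  | zero => rw [zero_add, pow_one, coeff_tMul_zero, coeff_C_zero, Nat.cast_one, one_mul]
  | succ i ih =>
    rw [pow_succ', AddMonoid.End.coe_mul, Function.comp_apply, coeff_tMul_succ, ih,
      coeff_tMul_pow_C_self, Nat.cast_succ (i + 1), add_one_mul]

theorem coeff_mul (f g : DiffPoly δ) {M : ℕ} (hf : f.natDegree ≤ M) (n : ℕ) :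
    coeff (f * g) n =
      ∑ i ∈ Finset.range (M + 1), coeff f i * ((tMul δ ^ i) (toPoly g)).coeff n := by
  have h : leftMul δ (toPoly f) =
      ∑ i ∈ Finset.range (M + 1), cMul (coeff f i) * tMul δ ^ i :=
    sum_over_range' (toPoly f) (f := fun i a => cMul a * tMul δ ^ i)
      (fun i => by rw [cMul_zero, zero_mul]) _ (Nat.lt_succ_of_le hf)
  rw [coeff, toPoly_mul, h]
  refine (congrArg (Polynomial.coeff · n) (AddMonoidHom.finsetSum_apply _ _ _)).trans ?_
  rw [finsetSum_coeff]
  exact Finset.sum_congr rfl fun i _ => coeff_C_mul _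

theorem coeff_mul_eq_zero {f g : DiffPoly δ} {M N : ℕ} (hf : f.natDegree ≤ M)
    (hg : g.natDegree ≤ N) {n : ℕ} (hn : M + N < n) : coeff (f * g) n = 0 := by
  rw [coeff_mul f g hf]
  refine Finset.sum_eq_zero fun i hi => ?_
  rw [Finset.mem_range] at hi
  rw [coeff_tMul_pow_eq_zero hg _ (by omega), mul_zero]

theorem coeff_mul_add {f g : DiffPoly δ} {M N : ℕ} (hf : f.natDegree ≤ M)
    (hg : g.natDegree ≤ N) : coeff (f * g) (M + N) = coeff f M * coeff g N := by
  rw [coeff_mul f g hf, Finset.sum_range_succ, coeff_tMul_pow_add hg, Finset.sum_eq_zero, zero_add]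
  · rfl
  · intro i hi
    rw [Finset.mem_range] at hi
    rw [coeff_tMul_pow_eq_zero hg _ (by omega), mul_zero]

theorem coeff_mul_const_self {f : DiffPoly δ} {k : ℕ} (hf : f.natDegree ≤ k) (y : D) :
    coeff (f * const δ y) k = coeff f k * y := by
  have h := coeff_mul_add hf (natDegree_C y).le (g := const δ y)
  rwa [add_zero, show coeff (const δ y) 0 = y from coeff_C_zero] at h

theorem coeff_mul_const {f : DiffPoly δ} {k : ℕ} (hf : f.natDegree ≤ k + 1) (y : D) :
    coeff (f * const δ y) k = coeff f k * y + coeff f (k + 1) * ((k + 1 : ℕ) * δ y) := by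
  have hC : toPoly (const δ y) = Polynomial.C y := rfl
  rw [coeff_mul f _ hf, Finset.sum_range_succ, Finset.sum_range_succ, Finset.sum_eq_zero, hC,
    coeff_tMul_pow_succ_C, coeff_tMul_pow_C_self, zero_add]
  intro i hi
  rw [Finset.mem_range] at hi
  rw [hC, coeff_tMul_pow_eq_zero (natDegree_C y).le _ (by omega), mul_zero]

theorem toPoly_mul_t (f : DiffPoly δ) : toPoly (f * t δ) = toPoly f * Polynomial.X := by
  conv_lhs => rw [f.eq_sum]
  conv_rhs => rw [(toPoly f).as_sum_support]
  simp only [Finset.sum_mul, map_sum, mul_assoc, ← pow_succ, toPoly_const_mul_t_pow,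
    monomial_mul_X]
  rfl

theorem toPoly_t_mul (f : DiffPoly δ) : toPoly (t δ * f) = tMul δ (toPoly f) := by
  rw [toPoly_mul, toPoly_t, leftMul_monomial, cMul_one, one_mul, pow_one]

theorem toPoly_const_mul (a : D) (f : DiffPoly δ) :
    toPoly (const δ a * f) = Polynomial.C a * toPoly f := by
  rw [toPoly_mul, toPoly_const, leftMul_monomial, pow_zero, mul_one, cMul_apply]

theorem coeff_const_mul (a : D) (f : DiffPoly δ) (n : ℕ) :
    coeff (const δ a * f) n = a * coeff f n := by
  rw [coeff, toPoly_const_mul, coeff_C_mul]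
  rfl

theorem coeff_sub (f g : DiffPoly δ) (n : ℕ) : coeff (f - g) n = coeff f n - coeff g n := by
  simp only [coeff, map_sub, Polynomial.coeff_sub]

theorem degree_zero : degree (0 : DiffPoly δ) = ⊥ := by
  rw [degree, map_zero, Polynomial.degree_zero]

theorem degree_eq_bot {f : DiffPoly δ} : degree f = ⊥ ↔ f = 0 := by
  rw [degree, Polynomial.degree_eq_bot, map_eq_zero_iff _ toPoly.injective]

theorem degree_eq_natDegree {f : DiffPoly δ} (hf : f ≠ 0) : degree f = natDegree f :=
  Polynomial.degree_eq_natDegree ((map_ne_zero_iff _ toPoly.injective).mpr hf)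

theorem coeff_natDegree_ne_zero {f : DiffPoly δ} (hf : f ≠ 0) : coeff f (natDegree f) ≠ 0 :=
  leadingCoeff_ne_zero.mpr ((map_ne_zero_iff _ toPoly.injective).mpr hf)

theorem natDegree_const (a : D) : natDegree (const δ a) = 0 := natDegree_C a

theorem eq_const_of_natDegree_eq_zero {f : DiffPoly δ} (hf : f.natDegree = 0) :
    f = const δ (coeff f 0) := toPoly.injective (eq_C_of_natDegree_eq_zero hf)

theorem const_injective : Function.Injective (const δ) := fun _ _ h =>
  Polynomial.C_injective (congrArg toPoly h)

instance [Nontrivial D] : Nontrivial (DiffPoly δ) := const_injective.nontrivial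

theorem Monic.ne_zero [Nontrivial D] {f : DiffPoly δ} (hf : f.Monic) : f ≠ 0 := by
  rintro rfl
  exact Polynomial.Monic.ne_zero hf (map_zero _)

variable (δ) in
noncomputable instance : Module D (DiffPoly δ) := Module.compHom _ (const δ)

theorem smul_eq_const_mul (a : D) (f : DiffPoly δ) : a • f = const δ a * f := rfl

instance : IsScalarTower D (DiffPoly δ) (DiffPoly δ) :=
  ⟨fun a f g => mul_assoc (const δ a) f g⟩

end Ring

section DivisionRing

variable {D : Type*} [DivisionRing D] {δ : RingDer D}

instance : IsScalarTower δ.centralConstants D (DiffPoly δ) where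
  smul_assoc a b f := by
    rw [Subfield.smul_def, smul_eq_mul, smul_eq_const_mul, map_mul, mul_assoc]
    rfl

theorem coeff_natDegree_add_mul_ne_zero {f g : DiffPoly δ} (hf : f ≠ 0) (hg : g ≠ 0) :
    coeff (f * g) (natDegree f + natDegree g) ≠ 0 := by
  rw [coeff_mul_add le_rfl le_rfl]
  exact mul_ne_zero (coeff_natDegree_ne_zero hf) (coeff_natDegree_ne_zero hg)

instance : IsDomain (DiffPoly δ) :=
  have : NoZeroDivisors (DiffPoly δ) := ⟨fun {f g} h => by
    by_contra! hfg
    refine coeff_natDegree_add_mul_ne_zero hfg.1 hfg.2 ?_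
    rw [h, coeff, map_zero, Polynomial.coeff_zero]⟩
  NoZeroDivisors.to_isDomain _

theorem natDegree_mul {f g : DiffPoly δ} (hf : f ≠ 0) (hg : g ≠ 0) :
    natDegree (f * g) = natDegree f + natDegree g :=
  le_antisymm (natDegree_le_iff_coeff_eq_zero.mpr fun _ => coeff_mul_eq_zero le_rfl le_rfl)
    (le_natDegree_of_ne_zero (coeff_natDegree_add_mul_ne_zero hf hg))

theorem leadingCoeff_mul (f g : DiffPoly δ) :
    (toPoly (f * g)).leadingCoeff = (toPoly f).leadingCoeff * (toPoly g).leadingCoeff := by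
  rcases eq_or_ne f 0 with rfl | hf
  · rw [zero_mul, map_zero, Polynomial.leadingCoeff_zero, zero_mul]
  rcases eq_or_ne g 0 with rfl | hg
  · rw [mul_zero, map_zero, Polynomial.leadingCoeff_zero, mul_zero]
  have h := coeff_mul_add (f := f) (g := g) le_rfl le_rfl
  rwa [← natDegree_mul hf hg] at h

theorem degree_mul (f g : DiffPoly δ) : degree (f * g) = degree f + degree g := by
  rcases eq_or_ne f 0 with rfl | hf
  · rw [zero_mul, degree_zero, WithBot.bot_add]
  rcases eq_or_ne g 0 with rfl | hg
  · rw [mul_zero, degree_zero, WithBot.add_bot]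
  rw [degree_eq_natDegree (mul_ne_zero hf hg), natDegree_mul hf hg, degree_eq_natDegree hf,
    degree_eq_natDegree hg, Nat.cast_add]

theorem Monic.of_mul_right {f g : DiffPoly δ} (hg : g.Monic) (hfg : (f * g).Monic) :
    f.Monic := by
  rwa [Monic, Polynomial.Monic, leadingCoeff_mul, hg, mul_one] at hfg

theorem exists_degree_sub_mul_lt {f g : DiffPoly δ} (hf : f ≠ 0) (hg : g ≠ 0)
    (hgf : degree g ≤ degree f) : ∃ q, degree (f - q * g) < degree f := by
  have hgf' : natDegree g ≤ natDegree f := natDegree_le_natDegree hgf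
  have hg' : (toPoly g).leadingCoeff ≠ 0 := coeff_natDegree_ne_zero hg
  let u := (toPoly f).leadingCoeff * (toPoly g).leadingCoeff⁻¹
  have hu : u ≠ 0 := mul_ne_zero (coeff_natDegree_ne_zero hf) (inv_ne_zero hg')
  let q : DiffPoly δ := const δ u * t δ ^ (natDegree f - natDegree g)
  have hq : toPoly q = monomial (natDegree f - natDegree g) u := toPoly_const_mul_t_pow _ _
  have hqd : degree q = (natDegree f - natDegree g : ℕ) :=
    (congrArg Polynomial.degree hq).trans (degree_monomial _ hu)
  refine ⟨q, ?_⟩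
  rw [degree, map_sub]
  refine Polynomial.degree_sub_lt_left ?_ ((map_ne_zero_iff _ toPoly.injective).mpr hf) ?_
  · change degree f = degree (q * g)
    rw [degree_mul, hqd, degree_eq_natDegree hf, degree_eq_natDegree hg, ← Nat.cast_add,
      Nat.sub_add_cancel hgf']
  · rw [leadingCoeff_mul, hq, leadingCoeff_monomial, inv_mul_cancel_right₀ hg']

theorem exists_eq_mul_add_degree_lt {g : DiffPoly δ} (hg : g ≠ 0) (f : DiffPoly δ) :
    ∃ q r, f = q * g + r ∧ degree r < degree g := by
  induction hn : degree f using WellFoundedLT.induction generalizing f with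
  | ind n ih =>
    rcases lt_or_ge (degree f) (degree g) with hlt | hle
    · exact ⟨0, f, by rw [zero_mul, zero_add], hlt⟩
    have hf : f ≠ 0 := fun h => hg (degree_eq_bot.mp (by rwa [h, degree_zero, le_bot_iff] at hle))
    obtain ⟨s, hs⟩ := exists_degree_sub_mul_lt hf hg hle
    obtain ⟨q, r, hqr, hr⟩ := ih _ (hn ▸ hs) _ rfl
    exact ⟨s + q, r, by rw [add_mul, add_assoc, ← hqr, add_sub_cancel], hr⟩

theorem degree_le_of_mem_span {f q : DiffPoly δ} (hq : q ∈ Ideal.span {f}) (hq0 : q ≠ 0) :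
    degree f ≤ degree q := by
  obtain ⟨r, rfl⟩ := Ideal.mem_span_singleton'.mp hq
  obtain ⟨hr, hf⟩ := mul_ne_zero_iff.mp hq0
  rw [degree_eq_natDegree hq0, degree_eq_natDegree hf, natDegree_mul hr hf]
  exact_mod_cast Nat.le_add_left _ _

theorem eq_zero_of_mem_span_of_degree_lt {f q : DiffPoly δ} (hq : q ∈ Ideal.span {f})
    (hlt : degree q < degree f) : q = 0 :=
  by_contra fun h => (degree_le_of_mem_span hq h).not_gt hlt

theorem exists_monic_const_mul {f : DiffPoly δ} (hf : f ≠ 0) :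
    ∃ u : D, (const δ u * f).Monic ∧ degree (const δ u * f) = degree f := by
  have hu : (coeff f (natDegree f))⁻¹ ≠ 0 := inv_ne_zero (coeff_natDegree_ne_zero hf)
  refine ⟨(coeff f (natDegree f))⁻¹, ?_, ?_⟩
  · rw [Monic, Polynomial.Monic, leadingCoeff_mul]
    exact (congrArg (· * _) (leadingCoeff_C _)).trans
      (inv_mul_cancel₀ (coeff_natDegree_ne_zero hf))
  · rw [degree_mul]
    exact (congrArg (· + _) (degree_C hu)).trans (zero_add _)

theorem exists_monic_span_eq {J : Ideal (DiffPoly δ)} (hJ : J ≠ ⊥) :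
    ∃ f : DiffPoly δ, f.Monic ∧ J = Ideal.span {f} := by
  obtain ⟨u, ⟨huJ, hu0⟩, hmin⟩ := WellFounded.has_min
    (InvImage.wf degree (wellFounded_lt (α := WithBot ℕ))) {u : DiffPoly δ | u ∈ J ∧ u ≠ 0}
    ((Submodule.ne_bot_iff J).mp hJ)
  obtain ⟨w, hmonic, hdeg⟩ := exists_monic_const_mul hu0
  have hmem := J.mul_mem_left (const δ w) huJ
  refine ⟨_, hmonic, le_antisymm (fun v hv => ?_) ((Ideal.span_singleton_le_iff_mem J).mpr hmem)⟩
  obtain ⟨q, r, rfl, hr⟩ := exists_eq_mul_add_degree_lt hmonic.ne_zero v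
  have hrJ : r ∈ J := (J.add_mem_iff_right (J.mul_mem_left q hmem)).mp hv
  have hr0 : r = 0 := by_contra fun h => hmin r ⟨hrJ, h⟩ (hr.trans_eq hdeg)
  rw [hr0, add_zero]
  exact Ideal.mul_mem_left _ _ (Ideal.mem_span_singleton_self _)

theorem one_notMem_span {f : DiffPoly δ} (hf : 0 < f.natDegree) :
    (1 : DiffPoly δ) ∉ Ideal.span {f} := fun h =>
  hf.not_ge ((natDegree_le_natDegree (degree_le_of_mem_span h one_ne_zero)).trans
    (natDegree_const (δ := δ) 1).le)

theorem isUnit_of_natDegree_eq_zero {f : DiffPoly δ} (hf0 : f ≠ 0) (hf : f.natDegree = 0) :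
    IsUnit f := by
  rw [eq_const_of_natDegree_eq_zero hf] at hf0 ⊢
  exact (IsUnit.mk0 _ ((map_ne_zero_iff _ const_injective).mp hf0)).map (const δ)

/-- Division with remainder on the right, as an identification of the polynomials of degree less
than that of `f` with `R / R f`. -/
noncomputable def degreeLTEquivQuotient {f : DiffPoly δ} (hf : f ≠ 0) :
    degreeLT D f.natDegree ≃ₗ[D] DiffPoly δ ⧸ Ideal.span {f} :=
  LinearEquiv.ofBijective
    { toFun q := Submodule.Quotient.mk (toPoly.symm q.1)
      map_add' q r := by
        rw [Submodule.coe_add, map_add, Submodule.Quotient.mk_add]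
      map_smul' a q := by
        rw [RingHom.id_apply, ← Submodule.Quotient.mk_smul, Submodule.coe_smul,
          smul_eq_const_mul]
        congr 1
        rw [AddEquiv.symm_apply_eq, toPoly_const_mul, AddEquiv.apply_symm_apply, C_mul'] } <| by
    have hdeg (q : D[X]) : q ∈ degreeLT D f.natDegree ↔ degree (toPoly.symm q : DiffPoly δ) <
        degree f := by
      rw [mem_degreeLT, degree_eq_natDegree hf, degree, AddEquiv.apply_symm_apply]
    constructor
    · refine (injective_iff_map_eq_zero _).mpr fun q hq => ?_
      have h0 := eq_zero_of_mem_span_of_degree_lt ((Submodule.Quotient.mk_eq_zero _).mp hq)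
        ((hdeg q).mp q.2)
      exact Subtype.ext ((map_eq_zero_iff _ toPoly.symm.injective).mp h0)
    · intro x
      obtain ⟨x, rfl⟩ := Submodule.Quotient.mk_surjective _ x
      obtain ⟨q, r, rfl, hr⟩ := exists_eq_mul_add_degree_lt hf x
      refine ⟨⟨toPoly r, (hdeg _).mpr (by rwa [AddEquiv.symm_apply_apply])⟩, ?_⟩
      refine (Submodule.Quotient.eq _).mpr ?_
      rw [AddEquiv.symm_apply_apply, sub_add_cancel_right, neg_mem_iff]
      exact Ideal.mul_mem_left _ q (Ideal.mem_span_singleton_self f)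

theorem finite_quotient_span {f : DiffPoly δ} (hf : f ≠ 0) :
    Module.Finite D (DiffPoly δ ⧸ Ideal.span {f}) :=
  .equiv ((degreeLTEquiv D _).symm.trans (degreeLTEquivQuotient hf))

theorem finrank_quotient_span {f : DiffPoly δ} (hf : f ≠ 0) :
    Module.finrank D (DiffPoly δ ⧸ Ideal.span {f}) = natDegree f := by
  rw [← ((degreeLTEquiv D _).symm.trans (degreeLTEquivQuotient hf)).finrank_eq,
    Module.finrank_fin_fun]

end DivisionRing

end DiffPoly

namespace DiffPoly

section Commutators

variable {D : Type*} [Ring D] {δ : RingDer D} {f : DiffPoly δ}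

theorem mem_center_of_commute (ht : t δ * f = f * t δ)
    (hc : ∀ y, const δ y * f = f * const δ y) : f ∈ Subring.center (DiffPoly δ) := by
  refine Subring.mem_center_iff.mpr fun g => ?_
  rw [g.eq_sum]
  exact Commute.sum_left _ _ _ fun i _ => Commute.mul_left (hc _) (Commute.pow_left ht i)

theorem coeff_t_mul_sub_mul_t (f : DiffPoly δ) (n : ℕ) :
    coeff (t δ * f - f * t δ) n = δ (coeff f n) := by
  rw [coeff_sub, coeff, coeff, toPoly_t_mul, toPoly_mul_t]
  cases n with
  | zero => rw [coeff_tMul_zero, mul_coeff_zero, coeff_X_zero, mul_zero, sub_zero, coeff]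
  | succ n => rw [coeff_tMul_succ, coeff_mul_X, add_sub_cancel_left, coeff]

theorem degree_t_mul_sub_mul_t_lt {n : ℕ} (hn : f.natDegree ≤ n) (hδ : δ (coeff f n) = 0) :
    degree (t δ * f - f * t δ) < n := by
  refine (degree_lt_iff_coeff_zero _ _).mpr fun m hm => (coeff_t_mul_sub_mul_t f m).trans ?_
  rcases hm.eq_or_lt with rfl | hm
  · exact hδ
  · rw [coeff, coeff_eq_zero_of_natDegree_lt (hn.trans_lt hm), map_zero]

theorem degree_const_mul_sub_mul_const_lt {n : ℕ} (hn : f.natDegree ≤ n) {y : D}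
    (hy : Commute y (coeff f n)) : degree (const δ y * f - f * const δ y) < n := by
  refine (degree_lt_iff_coeff_zero _ _).mpr fun m hm => ?_
  change coeff _ m = 0
  rw [coeff_sub, coeff_const_mul, coeff_mul_const_self (hn.trans hm), sub_eq_zero]
  rcases hm.eq_or_lt with rfl | hm
  · exact hy
  · rw [coeff, coeff_eq_zero_of_natDegree_lt (hn.trans_lt hm), mul_zero, zero_mul]

end Commutators

section DivisionRing

variable {D : Type*} [DivisionRing D] {δ : RingDer D}

theorem mem_center_of_forall_commutator_mem_span {h f : DiffPoly δ} (hh : h ≠ 0)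
    (hfh : f.natDegree ≤ h.natDegree) (hlead : coeff f h.natDegree ∈ δ.centralConstants)
    (hcomm : ∀ q, q * f - f * q ∈ Ideal.span {h}) : f ∈ Subring.center (DiffPoly δ) := by
  refine mem_center_of_commute (sub_eq_zero.mp ?_) fun y => sub_eq_zero.mp ?_ <;>
    refine eq_zero_of_mem_span_of_degree_lt (hcomm _) ?_ <;> rw [degree_eq_natDegree hh]
  · exact degree_t_mul_sub_mul_t_lt hfh hlead.2
  · exact degree_const_mul_sub_mul_const_lt hfh (Subring.mem_center_iff.mp hlead.1 y)

theorem Monic.mem_center_of_isTwoSided {u : DiffPoly δ} (hu : u.Monic)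
    [(Ideal.span {u}).IsTwoSided] : u ∈ Subring.center (DiffPoly δ) := by
  have hmem := Ideal.mem_span_singleton_self u
  refine mem_center_of_forall_commutator_mem_span hu.ne_zero le_rfl ?_ fun q =>
    sub_mem (Ideal.mul_mem_left _ q hmem) (Ideal.mul_mem_right q _ hmem)
  rw [show coeff u (natDegree u) = 1 from hu]
  exact one_mem _

theorem mul_comm_of_mem_center {h u w : DiffPoly δ} (hh : h ∈ Subring.center (DiffPoly δ))
    (huw : h = u * w) : h = w * u := by
  rcases eq_or_ne u 0 with rfl | hu
  · rw [huw, zero_mul, mul_zero]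
  · refine mul_left_cancel₀ hu ?_
    rw [← mul_assoc, ← huw, Subring.mem_center_iff.mp hh]

/-- `h` is central of positive degree, and all central elements of smaller degree are constants
from `F`. Such an `h` generates a maximal two-sided ideal. -/
structure IsMinimalCentral (h : DiffPoly δ) : Prop where
  mem_center : h ∈ Subring.center (DiffPoly δ)
  natDegree_pos : 0 < natDegree h
  exists_eq_const : ∀ q ∈ Subring.center (DiffPoly δ), degree q < degree h →
    ∃ b : δ.centralConstants, q = const δ b

namespace IsMinimalCentral

variable {h : DiffPoly δ}

theorem ne_zero (hh : IsMinimalCentral h) : h ≠ 0 := by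
  rintro rfl
  exact hh.natDegree_pos.ne' (by rw [natDegree, map_zero, natDegree_zero])

theorem isTwoSided (hh : IsMinimalCentral h) : (Ideal.span {h}).IsTwoSided where
  mul_mem_of_left := by
    intro x y hx
    obtain ⟨r, rfl⟩ := Ideal.mem_span_singleton'.mp hx
    rw [mul_assoc, ← Subring.mem_center_iff.mp hh.mem_center, ← mul_assoc]
    exact Ideal.mul_mem_left _ _ (Ideal.mem_span_singleton_self h)

theorem eq_top_of_span_lt (hh : IsMinimalCentral h) {I : Ideal (DiffPoly δ)} [I.IsTwoSided]
    (hI : Ideal.span {h} < I) : I = ⊤ := by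
  obtain ⟨u, hu, rfl⟩ := exists_monic_span_eq (bot_le.trans_lt hI).ne'
  obtain ⟨x, hxu, hxh⟩ := SetLike.exists_of_lt hI
  obtain ⟨q, r, rfl, hr⟩ := exists_eq_mul_add_degree_lt hh.ne_zero x
  have hqh : q * h ∈ Ideal.span {h} := Ideal.mul_mem_left _ _ (Ideal.mem_span_singleton_self h)
  have hr0 : r ≠ 0 := by
    rintro rfl
    exact hxh (by rwa [add_zero])
  have hru : r ∈ Ideal.span {u} := (Ideal.add_mem_iff_right _ (hI.le hqh)).mp hxu
  obtain ⟨b, rfl⟩ := hh.exists_eq_const u hu.mem_center_of_isTwoSided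
    ((degree_le_of_mem_span hru hr0).trans_lt hr)
  exact Ideal.eq_top_of_isUnit_mem _ (Ideal.mem_span_singleton_self _)
    (isUnit_of_natDegree_eq_zero hu.ne_zero (natDegree_const _))

theorem annihilator_quotient (hh : IsMinimalCentral h) {J : Ideal (DiffPoly δ)} (hJ : J ≠ ⊤)
    (hhJ : h ∈ J) : Module.annihilator (DiffPoly δ) (DiffPoly δ ⧸ J) = Ideal.span {h} := by
  have hle : Ideal.span {h} ≤ Module.annihilator (DiffPoly δ) (DiffPoly δ ⧸ J) := by
    refine (Ideal.span_singleton_le_iff_mem _).mpr (Module.mem_annihilator.mpr fun x => ?_)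
    obtain ⟨x, rfl⟩ := Submodule.Quotient.mk_surjective _ x
    rw [← Submodule.Quotient.mk_smul, Submodule.Quotient.mk_eq_zero, smul_eq_mul,
      ← Subring.mem_center_iff.mp hh.mem_center]
    exact J.mul_mem_left _ hhJ
  refine (hle.eq_of_not_lt fun hlt => hJ ?_).symm
  exact Submodule.Quotient.subsingleton_iff.mp
    (Module.annihilator_eq_top_iff.mp (hh.eq_top_of_span_lt hlt))

theorem isSimpleRing_quotient (hh : IsMinimalCentral h) [(Ideal.span {h}).IsTwoSided] :
    IsSimpleRing (DiffPoly δ ⧸ Ideal.span {h}) := by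
  have hne : Ideal.span {h} ≠ ⊤ :=
    (Ideal.ne_top_iff_one _).mpr (one_notMem_span hh.natDegree_pos)
  have := Ideal.Quotient.nontrivial_iff.mpr hne
  refine isSimpleRing_iff_isTwoSided_imp.mpr ⟨this, fun I _ => ?_⟩
  let π := Ideal.Quotient.mk (Ideal.span {h})
  have hle : Ideal.span {h} ≤ I.comap π := fun x hx => by
    rw [Ideal.mem_comap, Ideal.Quotient.eq_zero_iff_mem.mpr hx]
    exact zero_mem I
  rw [← Ideal.map_comap_of_surjective π Ideal.Quotient.mk_surjective I]
  rcases hle.eq_or_lt with heq | hlt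
  · exact .inl (heq ▸ Ideal.map_quotient_self _)
  · exact .inr (hh.eq_top_of_span_lt hlt ▸ Ideal.map_top π)

theorem isCentral_quotient (hh : IsMinimalCentral h) [(Ideal.span {h}).IsTwoSided] :
    Algebra.IsCentral δ.centralConstants (DiffPoly δ ⧸ Ideal.span {h}) := by
  refine ⟨fun x hx => ?_⟩
  obtain ⟨x, rfl⟩ := Ideal.Quotient.mk_surjective x
  obtain ⟨q, r, rfl, hr⟩ := exists_eq_mul_add_degree_lt hh.ne_zero x
  have hqr : Ideal.Quotient.mk (Ideal.span {h}) (q * h + r) = Ideal.Quotient.mk _ r := by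
    rw [Ideal.Quotient.eq, add_sub_cancel_right]
    exact Ideal.mul_mem_left _ _ (Ideal.mem_span_singleton_self h)
  rw [hqr] at hx ⊢
  have hcomm (y : DiffPoly δ) : y * r - r * y ∈ Ideal.span {h} := by
    rw [← Ideal.Quotient.eq, map_mul, map_mul, Subalgebra.mem_center_iff.mp hx]
  have hr0 : coeff r (natDegree h) = 0 := by
    rw [degree_eq_natDegree hh.ne_zero] at hr
    exact coeff_eq_zero_of_degree_lt hr
  have hrc := mem_center_of_forall_commutator_mem_span hh.ne_zero
    (natDegree_le_natDegree hr.le) (hr0 ▸ zero_mem _) hcomm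
  obtain ⟨b, rfl⟩ := hh.exists_eq_const r hrc hr
  exact Algebra.mem_bot.mpr ⟨b, rfl⟩

theorem isGeneralisedAPolynomial (hh : IsMinimalCentral h) [Module.Finite δ.centralConstants D]
    {f : DiffPoly δ} (hf : 0 < natDegree f) (hhf : h ∈ Ideal.span {f}) :
    IsGeneralisedAPolynomial f := by
  have := hh.isTwoSided
  have := hh.isSimpleRing_quotient
  have := hh.isCentral_quotient
  have := finite_quotient_span hh.ne_zero
  have hfin : Module.Finite δ.centralConstants (DiffPoly δ ⧸ Ideal.span {h}) := by
    exact .trans D _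
  obtain ⟨hsimple, hcentral, hfinite⟩ := isCentralSimple_eigenring (k := δ.centralConstants)
    (by exact hfin) ((Ideal.span_singleton_le_iff_mem _).mpr hhf)
    (one_notMem_span hf)
  exact ⟨hsimple, hcentral, hfinite⟩

end IsMinimalCentral

end DivisionRing

end DiffPoly

theorem prod_ofFn_snoc {M ι : Type*} [Monoid M] (φ : ι → M) {m : ℕ} (v : Fin m → ι) (w : ι) :
    (List.ofFn fun i => φ (Fin.snoc (α := fun _ => ι) v w i)).prod =
      (List.ofFn fun i => φ (v i)).prod * φ w := by
  rw [List.ofFn_succ', List.prod_concat]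
  simp only [Fin.snoc_castSucc, Fin.snoc_last]

namespace DiffPoly

section LinearFactors

variable {D : Type*} [Ring D] {δ : RingDer D}

theorem toPoly_t_sub_const (α : D) : toPoly (t δ - const δ α) = X - Polynomial.C α := by
  rw [map_sub]
  rfl

theorem monic_t_sub_const (α : D) : (t δ - const δ α).Monic := by
  rw [Monic, toPoly_t_sub_const]
  exact monic_X_sub_C α

theorem natDegree_t_sub_const [Nontrivial D] (α : D) : natDegree (t δ - const δ α) = 1 := by
  rw [natDegree, toPoly_t_sub_const, natDegree_X_sub_C]

theorem Monic.eq_one {f : DiffPoly δ} (hf : f.Monic) (hf0 : f.natDegree = 0) : f = 1 :=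
  toPoly.injective (Polynomial.Monic.natDegree_eq_zero hf |>.mp hf0)

theorem Monic.exists_eq_t_sub_const {f : DiffPoly δ} (hf : f.Monic) (hf1 : f.natDegree = 1) :
    ∃ β, f = t δ - const δ β := by
  refine ⟨-coeff f 0, toPoly.injective ?_⟩
  rw [toPoly_t_sub_const, map_neg, sub_neg_eq_add]
  exact Polynomial.Monic.eq_X_add_C hf hf1

end LinearFactors

variable {D : Type*} [DivisionRing D] {δ : RingDer D}

section Span

variable {f g h : DiffPoly δ}

theorem mem_span_left_factor (hh : h ∈ Subring.center (DiffPoly δ))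
    (hfg : h ∈ Ideal.span {f * g}) : h ∈ Ideal.span {f} := by
  obtain ⟨q, hq⟩ := Ideal.mem_span_singleton'.mp hfg
  rw [← mul_assoc] at hq
  rw [mul_comm_of_mem_center hh hq.symm, ← mul_assoc]
  exact Ideal.mul_mem_left _ _ (Ideal.mem_span_singleton_self f)

theorem mem_span_right_factor (hfg : h ∈ Ideal.span {f * g}) : h ∈ Ideal.span {g} :=
  (Ideal.span_singleton_le_iff_mem _).mpr
    (Ideal.mul_mem_left _ _ (Ideal.mem_span_singleton_self g)) hfg

theorem natDegree_le_of_mem_span (hh : h ≠ 0) (hhf : h ∈ Ideal.span {f}) :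
    natDegree f ≤ natDegree h :=
  natDegree_le_natDegree (degree_le_of_mem_span hhf hh)

theorem Monic.eq_of_mem_span_of_natDegree_eq (hf : f.Monic) (hh : h.Monic)
    (hhf : h ∈ Ideal.span {f}) (hdeg : natDegree f = natDegree h) : f = h := by
  obtain ⟨q, rfl⟩ := Ideal.mem_span_singleton'.mp hhf
  have hq : q.Monic := hf.of_mul_right hh
  rw [natDegree_mul hq.ne_zero hf.ne_zero, right_eq_add] at hdeg
  rw [hq.eq_one hdeg, one_mul]

theorem natDegree_le_of_mul_mem_span_iff {s : DiffPoly δ} (hf : f ≠ 0) (hg : g ≠ 0)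
    (hs : ∀ r, r * s ∈ Ideal.span {f} ↔ r ∈ Ideal.span {g}) : natDegree g ≤ natDegree f := by
  let φ := (Ideal.span {g}).mapQ (Ideal.span {f})
    (LinearMap.toSpanSingleton (DiffPoly δ) (DiffPoly δ) s) fun r hr => (hs r).mpr hr
  have hφ : Function.Injective φ := by
    refine (injective_iff_map_eq_zero φ).mpr fun x hx => ?_
    obtain ⟨r, rfl⟩ := Submodule.Quotient.mk_surjective _ x
    exact (Submodule.Quotient.mk_eq_zero _).mpr
      ((hs r).mp ((Submodule.Quotient.mk_eq_zero _).mp hx))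
  have := finite_quotient_span hf
  rw [← finrank_quotient_span hf, ← finrank_quotient_span hg]
  exact LinearMap.finrank_le_finrank_of_injective (f := φ.restrictScalars D) hφ

theorem const_mem_span_t_sub_const {α k : D} :
    const δ k ∈ Ideal.span {t δ - const δ α} ↔ k = 0 := by
  refine ⟨fun hk => by_contra fun hk0 => ?_, ?_⟩
  · have hle := natDegree_le_of_mem_span ((map_ne_zero_iff _ const_injective).mpr hk0) hk
    rw [natDegree_t_sub_const, natDegree_const] at hle
    exact absurd hle one_ne_zero.bot_lt.not_ge
  · rintro rfl
    rw [map_zero]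
    exact zero_mem _

-- For `v ≠ 0` the last term vanishes exactly when `β = Ω_v(α)`.
theorem t_sub_const_mul_const (α β v : D) : (t δ - const δ β) * const δ v =
    const δ v * (t δ - const δ α) + const δ (v * α + δ v - β * v) := by
  rw [sub_mul, t_mul_const, map_sub, map_add, map_mul, map_mul, mul_sub]
  abel

theorem exists_eq_Omega {α β : D} {s : DiffPoly δ} (hs : s ∉ Ideal.span {t δ - const δ α})
    (hβ : (t δ - const δ β) * s ∈ Ideal.span {t δ - const δ α}) :
    ∃ v ≠ 0, β = Omega δ v α := by
  have hmem (q : DiffPoly δ) : q * (t δ - const δ α) ∈ Ideal.span {t δ - const δ α} :=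
    Ideal.mul_mem_left _ q (Ideal.mem_span_singleton_self _)
  obtain ⟨q, r, rfl, hr⟩ := exists_eq_mul_add_degree_lt (monic_t_sub_const α).ne_zero s
  have hr0 : natDegree r = 0 := by
    rw [degree_eq_natDegree (monic_t_sub_const α).ne_zero, natDegree_t_sub_const] at hr
    exact natDegree_eq_zero_iff_degree_le_zero.mpr (Nat.WithBot.lt_one_iff_le_zero.mp hr)
  obtain ⟨v, rfl⟩ : ∃ v, r = const δ v := ⟨_, eq_const_of_natDegree_eq_zero hr0⟩
  have hv : v ≠ 0 := by
    rintro rfl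
    exact hs (by simpa only [map_zero, add_zero] using hmem q)
  rw [mul_add, ← mul_assoc, t_sub_const_mul_const α, ← add_assoc, ← add_mul,
    Ideal.add_mem_iff_right _ (hmem _), const_mem_span_t_sub_const, sub_eq_zero] at hβ
  exact ⟨v, hv, by rw [Omega, ← add_mul, hβ, mul_inv_cancel_right₀ hv]⟩

theorem Omega_one (α : D) : Omega δ 1 α = α := by
  rw [Omega, δ.map_one_eq_zero, inv_one, one_mul, mul_one, zero_mul, add_zero]

end Span

namespace IsMinimalCentral

variable {h f₀ f : DiffPoly δ}

-- The factor `g` generates the annihilator of `s + R f₀` in `R / R f₀`, where `s` is chosen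
-- in `q R` for the left cofactor `q` of `f` in `h`.
theorem exists_right_factor (hh : IsMinimalCentral h) (hf₀ : 0 < natDegree f₀)
    (hhf₀ : h ∈ Ideal.span {f₀}) (hf : 0 < natDegree f) (hhf : h ∈ Ideal.span {f}) :
    ∃ g s : DiffPoly δ, g.Monic ∧ f ∈ Ideal.span {g} ∧ s ∉ Ideal.span {f₀} ∧
      ∀ r, r * s ∈ Ideal.span {f₀} ↔ r ∈ Ideal.span {g} := by
  obtain ⟨q, hqf⟩ := Ideal.mem_span_singleton'.mp hhf
  have hfq : h = f * q := mul_comm_of_mem_center hh.mem_center hqf.symm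
  have hq0 : q ≠ 0 := left_ne_zero_of_mul (hqf ▸ hh.ne_zero)
  have hf0 : f ≠ 0 := right_ne_zero_of_mul (hqf ▸ hh.ne_zero)
  have hq : q ∉ Ideal.span {h} := fun hmem => by
    have hle := natDegree_le_of_mem_span hq0 hmem
    rw [← hqf, natDegree_mul hq0 hf0] at hle
    omega
  have hne : Ideal.span {f₀} ≠ ⊤ := (Ideal.ne_top_iff_one _).mpr (one_notMem_span hf₀)
  rw [← hh.annihilator_quotient hne hhf₀, Module.mem_annihilator, not_forall] at hq
  obtain ⟨x, hx⟩ := hq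
  obtain ⟨v, rfl⟩ := Submodule.Quotient.mk_surjective _ x
  rw [← Submodule.Quotient.mk_smul, Submodule.Quotient.mk_eq_zero, smul_eq_mul] at hx
  let J : Ideal (DiffPoly δ) :=
    Submodule.comap (LinearMap.toSpanSingleton (DiffPoly δ) (DiffPoly δ) (q * v)) (Ideal.span {f₀})
  have hfJ : f ∈ J := by
    change f * (q * v) ∈ Ideal.span {f₀}
    rw [← mul_assoc, ← hfq, ← Subring.mem_center_iff.mp hh.mem_center]
    exact Ideal.mul_mem_left _ _ hhf₀
  obtain ⟨g, hg, hJ⟩ := exists_monic_span_eq ((Submodule.ne_bot_iff J).mpr ⟨f, hfJ, hf0⟩)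
  exact ⟨g, q * v, hg, hJ ▸ hfJ, hx, fun r => hJ ▸ Iff.rfl⟩

theorem exists_right_factor_natDegree_le (hh : IsMinimalCentral h) (hf₀ : 0 < natDegree f₀)
    (hhf₀ : h ∈ Ideal.span {f₀}) (hf : 0 < natDegree f) (hhf : h ∈ Ideal.span {f}) :
    ∃ g : DiffPoly δ, g.Monic ∧ f ∈ Ideal.span {g} ∧ 0 < natDegree g ∧
      natDegree g ≤ natDegree f₀ ∧ ∃ s ∉ Ideal.span {f₀}, g * s ∈ Ideal.span {f₀} := by
  obtain ⟨g, s, hg, hfg, hs, hiff⟩ := hh.exists_right_factor hf₀ hhf₀ hf hhf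
  have hgs : g * s ∈ Ideal.span {f₀} := (hiff g).mpr (Ideal.mem_span_singleton_self g)
  refine ⟨g, hg, hfg, Nat.pos_of_ne_zero fun hg0 => hs ?_,
    natDegree_le_of_mul_mem_span_iff ?_ hg.ne_zero hiff, s, hs, hgs⟩
  · rwa [hg.eq_one hg0, one_mul] at hgs
  · rintro rfl
    exact hf₀.ne' natDegree_zero

theorem natDegree_dvd_of_forall_le (hh : IsMinimalCentral h) (hf₀ : 0 < natDegree f₀)
    (hhf₀ : h ∈ Ideal.span {f₀})
    (hmin : ∀ g : DiffPoly δ, 0 < natDegree g → h ∈ Ideal.span {g} → natDegree f₀ ≤ natDegree g)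
    (hhf : h ∈ Ideal.span {f}) : natDegree f₀ ∣ natDegree f := by
  induction hn : natDegree f using Nat.strong_induction_on generalizing f with
  | _ n ih =>
    subst hn
    rcases (natDegree f).eq_zero_or_pos with hf | hf
    · exact hf ▸ dvd_zero _
    obtain ⟨g, hg, hfg, hg0, hgle, -⟩ :=
      hh.exists_right_factor_natDegree_le hf₀ hhf₀ hf hhf
    obtain ⟨x, rfl⟩ := Ideal.mem_span_singleton'.mp hfg
    have hx : x ≠ 0 := by
      rintro rfl
      exact hf.ne' (by rw [zero_mul]; exact natDegree_zero)
    rw [natDegree_mul hx hg.ne_zero] at ih ⊢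
    have hgf₀ := hgle.antisymm (hmin g hg0 (mem_span_right_factor hhf))
    rw [hgf₀] at hg0 ih ⊢
    exact dvd_add (ih _ (Nat.lt_add_of_pos_right hg0) (mem_span_left_factor hh.mem_center hhf) rfl)
      dvd_rfl

section Prime

variable (hh : IsMinimalCentral h) (hprime : (natDegree h).Prime)
  (hlin : ∀ α : D, h ∉ Ideal.span {t δ - const δ α})

include hh hprime hlin

theorem natDegree_eq_of_forall_notMem_span (hf : 0 < natDegree f) (hhf : h ∈ Ideal.span {f}) :
    natDegree f = natDegree h := by
  obtain ⟨f₀, ⟨hf₀, hhf₀⟩, hmin⟩ := exists_minimalFor_of_wellFoundedLT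
    (fun g : DiffPoly δ => 0 < natDegree g ∧ h ∈ Ideal.span {g}) natDegree ⟨f, hf, hhf⟩
  have hmin' (g : DiffPoly δ) (hg : 0 < natDegree g) (hhg : h ∈ Ideal.span {g}) :
      natDegree f₀ ≤ natDegree g := (le_total _ _).elim id (hmin ⟨hg, hhg⟩)
  have hdvd := hh.natDegree_dvd_of_forall_le hf₀ hhf₀ hmin' (Ideal.mem_span_singleton_self h)
  rcases (Nat.dvd_prime hprime).mp hdvd with h1 | h1
  · obtain ⟨g, hg, hfg, hg0, hgle, -⟩ :=
      hh.exists_right_factor_natDegree_le hf₀ hhf₀ hf₀ hhf₀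
    obtain ⟨β, rfl⟩ := hg.exists_eq_t_sub_const ((hgle.trans h1.le).antisymm hg0)
    exact absurd ((Ideal.span_singleton_le_iff_mem _).mpr hfg hhf₀) (hlin β)
  · exact (natDegree_le_of_mem_span hh.ne_zero hhf).antisymm (h1 ▸ hmin' f hf hhf)

theorem irreducible_of_forall_notMem_span : Irreducible h where
  not_isUnit hu := one_notMem_span hh.natDegree_pos
    ((Ideal.eq_top_of_isUnit_mem _ (Ideal.mem_span_singleton_self h) hu) ▸ Submodule.mem_top)
  isUnit_or_isUnit u w huw := by
    have hu : u ≠ 0 := left_ne_zero_of_mul (huw ▸ hh.ne_zero)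
    have hw : w ≠ 0 := right_ne_zero_of_mul (huw ▸ hh.ne_zero)
    have hdeg : natDegree h = natDegree u + natDegree w := huw ▸ natDegree_mul hu hw
    have hhw : h ∈ Ideal.span {w} := Ideal.mem_span_singleton'.mpr ⟨u, huw.symm⟩
    rcases (natDegree w).eq_zero_or_pos with hw0 | hw0
    · exact .inr (isUnit_of_natDegree_eq_zero hw hw0)
    · have := hh.natDegree_eq_of_forall_notMem_span hprime hlin hw0 hhw
      exact .inl (isUnit_of_natDegree_eq_zero hu (by omega))

end Prime

variable {α : D}

theorem exists_eq_mul_t_sub_Omega (hh : IsMinimalCentral h)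
    (hα : h ∈ Ideal.span {t δ - const δ α}) {m : ℕ} (hf : f.Monic) (hm : natDegree f = m + 1)
    (hhf : h ∈ Ideal.span {f}) :
    ∃ v ≠ 0, ∃ x : DiffPoly δ, x.Monic ∧ natDegree x = m ∧
      f = x * (t δ - const δ (Omega δ v α)) := by
  obtain ⟨g, hg, hfg, hg0, hgle, s, hs, hgs⟩ := hh.exists_right_factor_natDegree_le
    ((natDegree_t_sub_const α).symm ▸ zero_lt_one) hα (hm ▸ m.succ_pos) hhf
  obtain ⟨β, rfl⟩ :=
    hg.exists_eq_t_sub_const ((hgle.trans (natDegree_t_sub_const α).le).antisymm hg0)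
  obtain ⟨v, hv, rfl⟩ := exists_eq_Omega hs hgs
  obtain ⟨x, rfl⟩ := Ideal.mem_span_singleton'.mp hfg
  have hx : x.Monic := hg.of_mul_right hf
  refine ⟨v, hv, x, hx, ?_, rfl⟩
  rwa [natDegree_mul hx.ne_zero hg.ne_zero, natDegree_t_sub_const, Nat.add_right_cancel_iff] at hm

theorem exists_eq_prod_t_sub_Omega (hh : IsMinimalCentral h)
    (hα : h ∈ Ideal.span {t δ - const δ α}) {m : ℕ} (hf : f.Monic) (hm : natDegree f = m)
    (hhf : h ∈ Ideal.span {f}) :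
    ∃ v : Fin m → D, (∀ i, v i ≠ 0) ∧
      f = (List.ofFn fun i => t δ - const δ (Omega δ (v i) α)).prod := by
  induction m generalizing f with
  | zero => exact ⟨Fin.elim0, fun i => i.elim0, by rw [hf.eq_one hm, List.ofFn_zero, List.prod_nil]⟩
  | succ m ih =>
    obtain ⟨w, hw, x, hx, hxm, rfl⟩ := hh.exists_eq_mul_t_sub_Omega hα hf hm hhf
    obtain ⟨v, hv, rfl⟩ := ih hx hxm (mem_span_left_factor hh.mem_center hhf)
    refine ⟨Fin.snoc v w, Fin.forall_fin_succ'.mpr ?_, ?_⟩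
    · simpa only [Fin.snoc_castSucc, Fin.snoc_last] using ⟨hv, hw⟩
    · exact (prod_ofFn_snoc (fun u => t δ - const δ (Omega δ u α)) v w).symm

-- The last factor `t - Ω_w(α₀)` is made `t - α` by taking `α = Ω_w(α₀)` as the new base point.
theorem exists_eq_prod_t_sub_Omega_last_eq_one (hh : IsMinimalCentral h) {α₀ : D}
    (hα₀ : h ∈ Ideal.span {t δ - const δ α₀}) {m : ℕ} (hf : f.Monic) (hm : natDegree f = m + 1)
    (hhf : h ∈ Ideal.span {f}) :
    ∃ (v : Fin (m + 1) → D) (α : D), (∀ i, v i ≠ 0) ∧ v (Fin.last m) = 1 ∧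
      f = (List.ofFn fun i => t δ - const δ (Omega δ (v i) α)).prod ∧
      h ∈ Ideal.span {t δ - const δ α} := by
  obtain ⟨w, -, x, hx, hxm, rfl⟩ := hh.exists_eq_mul_t_sub_Omega hα₀ hf hm hhf
  have hα := mem_span_right_factor hhf
  obtain ⟨v, hv, rfl⟩ :=
    hh.exists_eq_prod_t_sub_Omega hα hx hxm (mem_span_left_factor hh.mem_center hhf)
  refine ⟨Fin.snoc v 1, Omega δ w α₀, Fin.forall_fin_succ'.mpr ?_, Fin.snoc_last _ _, ?_, hα⟩
  · simpa only [Fin.snoc_castSucc, Fin.snoc_last] using ⟨hv, one_ne_zero⟩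
  · refine .trans ?_ (prod_ofFn_snoc (fun u => t δ - const δ (Omega δ u _)) v 1).symm
    rw [Omega_one]

end IsMinimalCentral

end DiffPoly

namespace RingDer

variable {D : Type*} [DivisionRing D] {δ : RingDer D}

theorem polyApply_monomial (i : ℕ) (r : δ.centralConstants) (x : D) :
    δ.polyApply (monomial i r) x = r * δ^[i] x :=
  Polynomial.sum_monomial_index _ (fun i (r : δ.centralConstants) => (r : D) * δ^[i] x)
    (zero_mul _)

theorem polyApply_add (P Q : (δ.centralConstants)[X]) (x : D) :
    δ.polyApply (P + Q) x = δ.polyApply P x + δ.polyApply Q x :=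
  Polynomial.sum_add_index _ _ (fun i (r : δ.centralConstants) => (r : D) * δ^[i] x)
    (fun _ => zero_mul _) fun _ _ _ => add_mul _ _ _

theorem polyApply_X_pow_sub_C_mul_X (n : ℕ) (a : δ.centralConstants) (x : D) :
    δ.polyApply (X ^ n - C a * X) x = δ^[n] x - a * δ x := by
  rw [sub_eq_add_neg, ← neg_mul, ← C_neg, C_mul_X_eq_monomial, X_pow_eq_monomial, polyApply_add,
    polyApply_monomial, polyApply_monomial, Function.iterate_one, Subring.coe_one, one_mul,
    Subring.coe_neg, neg_mul, sub_eq_add_neg]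

theorem IsMinimumPolynomial.not_isInnerBy_mul {g : (δ.centralConstants)[X]}
    (hg : δ.IsMinimumPolynomial g) (hdeg : 1 < g.natDegree) {r : δ.centralConstants} (hr : r ≠ 0)
    (e : D) : ¬ IsInnerBy (fun x => r * δ x) e := by
  intro h
  have hle := hg.minimal (monomial 1 r) ((monomial_eq_zero_iff r 1).not.mpr hr)
    ⟨e, fun x => (polyApply_monomial 1 r x).trans (h x)⟩
  rw [degree_monomial 1 hr, degree_eq_natDegree hg.monic.ne_zero, Nat.cast_le] at hle
  exact hle.not_gt hdeg

end RingDer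

namespace DiffPoly

variable {D : Type*} [DivisionRing D] {δ : RingDer D}

section Central

variable {q : DiffPoly δ}

theorem coeff_natDegree_mem_centralConstants (hq : q ∈ Subring.center (DiffPoly δ)) :
    coeff q (natDegree q) ∈ δ.centralConstants := by
  rw [Subring.mem_center_iff] at hq
  refine ⟨Subring.mem_center_iff.mpr fun y => ?_, ?_⟩
  · rw [← coeff_mul_const_self le_rfl, ← hq, coeff_const_mul]
  · rw [← coeff_t_mul_sub_mul_t, hq, sub_self, coeff, map_zero, Polynomial.coeff_zero]

theorem coeff_succ_mul_der_of_mem_center (hq : q ∈ Subring.center (DiffPoly δ)) {k : ℕ}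
    (hk : natDegree q ≤ k + 1) (y : D) :
    coeff q (k + 1) * ((k + 1 : ℕ) * δ y) = y * coeff q k - coeff q k * y := by
  rw [eq_sub_iff_add_eq', ← coeff_mul_const hk, ← Subring.mem_center_iff.mp hq, coeff_const_mul]

theorem exists_eq_const_of_mem_center {p : ℕ} [CharP D p]
    (hδ : ∀ r : δ.centralConstants, r ≠ 0 → ∀ e, ¬ RingDer.IsInnerBy (fun x => r * δ x) e)
    (hq : q ∈ Subring.center (DiffPoly δ)) (hqp : degree q < p) :
    ∃ b : δ.centralConstants, q = const δ b := by
  have hlead := coeff_natDegree_mem_centralConstants hq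
  rcases hn : natDegree q with _ | k
  · rw [hn] at hlead
    exact ⟨⟨coeff q 0, hlead⟩, eq_const_of_natDegree_eq_zero hn⟩
  have hq0 : q ≠ 0 := by
    rintro rfl
    exact k.succ_ne_zero (hn.symm.trans natDegree_zero)
  rw [degree_eq_natDegree hq0, hn, Nat.cast_lt] at hqp
  rw [hn] at hlead
  have hk0 : ((k + 1 : ℕ) : D) ≠ 0 := fun h0 =>
    Nat.not_dvd_of_pos_of_lt k.succ_pos hqp ((CharP.cast_eq_zero_iff D p _).mp h0)
  let r : δ.centralConstants := ⟨_, mul_mem hlead (natCast_mem _ (k + 1))⟩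
  have hr : r ≠ 0 := Subtype.coe_ne_coe.mp
    (mul_ne_zero (hn ▸ coeff_natDegree_ne_zero hq0) hk0)
  refine absurd (fun y => ?_) (hδ r hr (-coeff q k))
  change coeff q (k + 1) * (k + 1 : ℕ) * δ y = _
  rw [mul_assoc, coeff_succ_mul_der_of_mem_center hq hn.le, neg_mul, mul_neg, sub_neg_eq_add,
    neg_add_eq_sub]

end Central

section Char

variable (p : ℕ) [Fact p.Prime] [CharP D p]

theorem t_sub_const_pow_char_mul_const (α y : D) :
    (t δ - const δ α) ^ p * const δ y - const δ y * t δ ^ p =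
      const δ ((fun w => δ w - α * w)^[p] y) := by
  have := charP_of_injective_ringHom (const_injective (δ := δ)) p
  let φ := LinearMap.mulLeft ℤ (t δ - const δ α) - LinearMap.mulRight ℤ (t δ)
  have hsemi : Function.Semiconj (const δ) (fun w => δ w - α * w) φ := fun w => by
    change _ = (t δ - const δ α) * const δ w - const δ w * t δ
    rw [sub_mul, t_mul_const, map_sub, map_mul]
    abel
  rw [hsemi.iterate_right p y, ← Module.End.pow_apply, mulLeft_sub_mulRight_pow_char]
  rfl

theorem t_pow_char_mul_const (y : D) :
    t δ ^ p * const δ y = const δ y * t δ ^ p + const δ (δ^[p] y) := by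
  have h := t_sub_const_pow_char_mul_const (δ := δ) p 0 y
  simp only [map_zero, sub_zero, zero_mul] at h
  exact sub_eq_iff_eq_add'.mp h

theorem t_sub_const_pow_char (α : D) : (t δ - const δ α) ^ p = t δ ^ p - const δ (V δ p α) := by
  have h := t_sub_const_pow_char_mul_const (δ := δ) p α 1
  rw [map_one, mul_one, one_mul, ← neg_inj, neg_sub, ← map_neg] at h
  rw [V, h, coeff, toPoly_const, coeff_monomial_same, ← h, sub_sub_cancel]

end Char

section ArtinSchreier

variable (δ) in
/-- The differential analogue `t ^ n - a t - k` of an Artin–Schreier polynomial. For `n = p` and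
`k = b + c` it is the element `g(t) - c - b`. -/
noncomputable def artinSchreier (n : ℕ) (a k : D) : DiffPoly δ :=
  t δ ^ n - const δ a * t δ - const δ k

theorem toPoly_artinSchreier (n : ℕ) (a k : D) : toPoly (artinSchreier δ n a k) =
    X ^ n - (Polynomial.C a * X + Polynomial.C k) := by
  have ht : toPoly (t δ ^ n) = X ^ n := by
    simpa only [map_one, one_mul, X_pow_eq_monomial] using toPoly_const_mul_t_pow (δ := δ) 1 n
  rw [artinSchreier, map_sub, map_sub, ht, toPoly_const_mul, sub_sub]
  rfl

theorem aeval_t_sub_const_sub_algebraMap (n : ℕ) (a b : δ.centralConstants) (c : D) :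
    aeval (t δ) (X ^ n - C a * X : (δ.centralConstants)[X]) - const δ c -
      algebraMap δ.centralConstants (DiffPoly δ) b = artinSchreier δ n a (b + c) := by
  rw [map_sub, map_pow, map_mul, aeval_X, aeval_C, sub_sub, add_comm (const δ c), artinSchreier,
    map_add]
  rfl

theorem monic_artinSchreier {n : ℕ} (hn : 1 < n) (a k : D) : (artinSchreier δ n a k).Monic := by
  rw [Monic, toPoly_artinSchreier]
  exact monic_X_pow_sub (degree_linear_le.trans_lt (by exact_mod_cast hn))

theorem natDegree_artinSchreier {n : ℕ} (hn : 1 < n) (a k : D) :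
    natDegree (artinSchreier δ n a k) = n := by
  rw [natDegree, toPoly_artinSchreier, natDegree_sub_eq_left_of_natDegree_lt, natDegree_X_pow]
  rw [natDegree_X_pow]
  exact natDegree_linear_le.trans_lt hn

variable {p : ℕ} [Fact p.Prime] [CharP D p]

theorem artinSchreier_mem_span_iff {a k α : D} :
    artinSchreier δ p a k ∈ Ideal.span {t δ - const δ α} ↔ V δ p α - a * α - k = 0 := by
  have hp : p ≠ 0 := (Fact.out : p.Prime).ne_zero
  have hsplit : artinSchreier δ p a k = ((t δ - const δ α) ^ (p - 1) - const δ a) *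
      (t δ - const δ α) + const δ (V δ p α - a * α - k) := by
    rw [sub_mul, pow_sub_one_mul hp, t_sub_const_pow_char, mul_sub, map_sub, map_sub, map_mul,
      artinSchreier]
    abel
  rw [hsplit, Ideal.add_mem_iff_right _
    (Ideal.mul_mem_left _ _ (Ideal.mem_span_singleton_self _)), const_mem_span_t_sub_const]

theorem artinSchreier_mem_center {a : δ.centralConstants} {k : D} (hδk : δ k = 0)
    (hk : ∀ x, δ^[p] x - a * δ x = k * x - x * k) :
    artinSchreier δ p a k ∈ Subring.center (DiffPoly δ) := by
  refine mem_center_of_commute ?_ fun y => ?_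
  · have htk : Commute (t δ) (const δ k) := by
      rw [commute_iff_eq, t_mul_const, hδk, map_zero, add_zero]
    have hta : Commute (t δ) (const δ (a : D)) := (const_mul_comm a (t δ)).symm
    exact ((Commute.self_pow _ _).sub_right (hta.mul_right (.refl _))).sub_right htk
  · have hat : const δ a * t δ * const δ y = const δ y * (const δ a * t δ) + const δ (a * δ y) := by
      rw [mul_assoc, t_mul_const, mul_add, ← mul_assoc, const_mul_comm, mul_assoc, map_mul]
    have hky : k * y = y * k + (δ^[p] y - a * δ y) := by rw [hk, add_sub_cancel]
    rw [artinSchreier, mul_sub, mul_sub, sub_mul, sub_mul, t_pow_char_mul_const, hat, ← map_mul,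
      ← map_mul, hky, map_add, map_sub]
    abel

theorem isMinimalCentral_artinSchreier {a : δ.centralConstants}
    (hg : δ.IsMinimumPolynomial (X ^ p - C a * X)) {c : D}
    (hc : RingDer.IsInnerBy (δ.polyApply (X ^ p - C a * X)) c) (hδc : δ c = 0)
    (b : δ.centralConstants) : IsMinimalCentral (artinSchreier δ p a (b + c)) := by
  have hp : 1 < p := (Fact.out : p.Prime).one_lt
  have hgp : (X ^ p - C a * X : (δ.centralConstants)[X]).natDegree = p := by
    rw [natDegree_sub_eq_left_of_natDegree_lt, natDegree_X_pow]
    rw [natDegree_X_pow]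
    exact ((natDegree_C_mul_le a X).trans natDegree_X_le).trans_lt hp
  refine ⟨artinSchreier_mem_center ?_ fun x => ?_, ?_, fun q hq hqp => ?_⟩
  · rw [map_add, hδc, add_zero]
    exact b.2.2
  · rw [← RingDer.polyApply_X_pow_sub_C_mul_X, hc, add_mul, mul_add,
      δ.commute_of_mem_centralConstants, add_sub_add_left_eq_sub]
  · rw [natDegree_artinSchreier hp]
    exact zero_lt_one.trans hp
  · rw [degree_eq_natDegree (monic_artinSchreier hp _ _).ne_zero,
      natDegree_artinSchreier hp] at hqp
    exact exists_eq_const_of_mem_center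
      (fun r hr => hg.not_isInnerBy_mul (hgp.symm ▸ hp) hr) hq hqp

theorem eq_or_exists_eq_prod_of_artinSchreier_mem_span {a k : D}
    (hz : IsMinimalCentral (artinSchreier δ p a k)) {f : DiffPoly δ} (hf : f.Monic)
    (hf0 : 0 < natDegree f) (hzf : artinSchreier δ p a k ∈ Ideal.span {f}) :
    (f = artinSchreier δ p a k ∧ ∀ α, V δ p α - a * α - k ≠ 0) ∨
      (natDegree f ≤ p ∧ ∃ (v : Fin (natDegree f) → D) (α : D),
        (∀ i, v i ≠ 0) ∧ (∀ i : Fin (natDegree f), (i : ℕ) + 1 = natDegree f → v i = 1) ∧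
        f = (List.ofFn fun i => t δ - const δ (Omega δ (v i) α)).prod ∧
        V δ p α - a * α - k = 0) := by
  have hp : p.Prime := Fact.out
  have hdeg : natDegree (artinSchreier δ p a k) = p := natDegree_artinSchreier hp.one_lt a k
  simp only [ne_eq, ← artinSchreier_mem_span_iff]
  by_cases hlin : ∀ α, artinSchreier δ p a k ∉ Ideal.span {t δ - const δ α}
  · exact .inl ⟨hf.eq_of_mem_span_of_natDegree_eq (monic_artinSchreier hp.one_lt a k) hzf
      (hz.natDegree_eq_of_forall_notMem_span (hdeg.symm ▸ hp) hlin hf0 hzf), hlin⟩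
  · refine .inr ⟨hdeg ▸ natDegree_le_of_mem_span hz.ne_zero hzf, ?_⟩
    simp only [not_forall, not_not] at hlin
    obtain ⟨α₀, hα₀⟩ := hlin
    obtain ⟨m, hm⟩ := Nat.exists_eq_add_one.mpr hf0
    obtain ⟨v, α, hv, hlast, hprod, hα⟩ :=
      hz.exists_eq_prod_t_sub_Omega_last_eq_one hα₀ hf hm hzf
    rw [hm]
    refine ⟨v, α, hv, fun i hi => ?_, hprod, hα⟩
    rwa [show i = Fin.last m from Fin.ext (Nat.succ_injective hi)]

end ArtinSchreier

end DiffPoly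

section EigenringScalars

variable {k R : Type*} [Field k] [Ring R] [Algebra k R]

theorem exists_sub_algebraMap_mem_span {f z : R} [Algebra.IsCentral k (Eigenring k f)]
    (hz : z ∈ Subring.center R) : ∃ b : k, z - algebraMap k R b ∈ Ideal.span {f} := by
  have hzf : z ∈ leftIdealiser k f := by
    change f * z ∈ Ideal.span {f}
    rw [Subring.mem_center_iff.mp hz]
    exact Ideal.mul_mem_left _ _ (Ideal.mem_span_singleton_self f)
  let π := Ideal.Quotient.mk (eigenIdeal k f)
  have hcenter : π ⟨z, hzf⟩ ∈ Subalgebra.center k (Eigenring k f) := by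
    refine Subalgebra.mem_center_iff.mpr (Ideal.Quotient.mk_surjective.forall.mpr fun y => ?_)
    rw [← map_mul, ← map_mul]
    exact congrArg π (Subtype.ext (Subring.mem_center_iff.mp hz y))
  obtain ⟨b, hb⟩ := Algebra.mem_bot.mp (Algebra.IsCentral.out hcenter)
  have hmem : (⟨z, hzf⟩ : leftIdealiser k f) - algebraMap k _ b ∈ eigenIdeal k f :=
    Ideal.Quotient.eq.mp hb.symm
  exact ⟨b, hmem⟩

theorem aeval_sub_algebraMap_eval_mem {J : Ideal R} {z : R} {b : k}
    (hb : z - algebraMap k R b ∈ J) (P : k[X]) :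
    aeval z P - algebraMap k R (P.eval b) ∈ J := by
  obtain ⟨Q, hQ⟩ := X_sub_C_dvd_sub_C_eval (a := b) (p := P)
  have hz := congrArg (aeval z) (hQ.trans (mul_comm _ _))
  simp only [map_sub, map_mul, aeval_C, aeval_X] at hz
  exact hz ▸ J.mul_mem_left _ hb

theorem eq_X_sub_C_of_aeval_mem {J : Ideal R} (hJ : (1 : R) ∉ J) {z : R} {b : k}
    (hb : z - algebraMap k R b ∈ J) {P : k[X]} (hP : P.Monic) (hirr : Irreducible P)
    (hPz : aeval z P ∈ J) : P = X - C b := by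
  have hroot : P.eval b = 0 := by
    by_contra hne
    have hmem := J.sub_mem hPz (aeval_sub_algebraMap_eval_mem hb P)
    rw [sub_sub_cancel] at hmem
    refine hJ ?_
    rw [← map_one (algebraMap k R), ← inv_mul_cancel₀ hne, map_mul]
    exact J.mul_mem_left _ hmem
  exact (eq_of_monic_of_associated (monic_X_sub_C b) hP
    ((irreducible_X_sub_C b).associated_of_dvd hirr (dvd_iff_isRoot.mpr hroot))).symm

end EigenringScalars

namespace DiffPoly

theorem IsMinimalCentralLeftMultiple.mem_span {D : Type*} [DivisionRing D] {δ : RingDer D}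
    {z f h : DiffPoly δ} {hhat : (δ.centralConstants)[X]}
    (hh : IsMinimalCentralLeftMultiple z f h hhat) : h ∈ Ideal.span {f} :=
  Ideal.mem_span_singleton'.mpr (hh.left_multiple.imp fun _ => Eq.symm)

theorem IsMinimalCentralLeftMultiple.isGeneralisedAPolynomial_iff {D : Type*} [DivisionRing D]
    {δ : RingDer D} [Module.Finite δ.centralConstants D] {z f h : DiffPoly δ}
    {hhat : (δ.centralConstants)[X]} (hh : IsMinimalCentralLeftMultiple z f h hhat)
    (hirr : Irreducible hhat) (hf : 0 < natDegree f)
    (hz : ∀ b : δ.centralConstants, IsMinimalCentral (z - algebraMap _ _ b)) :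
    IsGeneralisedAPolynomial f ↔ ∃ b : δ.centralConstants, h = z - algebraMap _ _ b := by
  refine ⟨fun hfA => ?_, ?_⟩
  · have := hfA.isCentral
    have hzc : z ∈ Subring.center (DiffPoly δ) := by
      simpa only [map_zero, sub_zero] using (hz 0).mem_center
    obtain ⟨b, hb⟩ := exists_sub_algebraMap_mem_span (k := δ.centralConstants) (f := f) hzc
    have hhat_eq := eq_X_sub_C_of_aeval_mem (one_notMem_span hf) hb hh.monic hirr
      (hh.eq_aeval ▸ hh.mem_span)
    exact ⟨b, by rw [hh.eq_aeval, hhat_eq, map_sub, aeval_X, aeval_C]⟩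
  · rintro ⟨b, rfl⟩
    exact (hz b).isGeneralisedAPolynomial hf hh.mem_span

end DiffPoly

open DiffPoly in
theorem theorem5 {D : Type*} [DivisionRing D]
    -- `D` has finite dimension over its centre, and prime characteristic `p`
    [Module.Finite (Subring.center D) D]
    (p : ℕ) [Fact p.Prime] [CharP D p]
    -- `g = xᵖ - a x` is the minimum polynomial of `δ`, and `g(δ) = δ_c`, with `δ(c) = 0`
    (δ : RingDer D) (a : δ.centralConstants) (c : D)
    (hg : δ.IsMinimumPolynomial (X ^ p - C a * X))
    (hc : RingDer.IsInnerBy (δ.polyApply (X ^ p - C a * X)) c)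
    (hδc : δ c = 0)
    -- `f` is monic of degree `m ≥ 1`
    (f : DiffPoly δ) (m : ℕ) (hf : f.Monic) (hm : f.natDegree = m) (hm1 : 1 ≤ m)
    -- `h = ĥ(g(t) - c)` is the minimal central left multiple of `f`, and `ĥ` is irreducible
    (h : DiffPoly δ) (hhat : (δ.centralConstants)[X])
    (hh : IsMinimalCentralLeftMultiple
      (aeval (t δ) (X ^ p - C a * X : (δ.centralConstants)[X]) - const δ c) f h hhat)
    (hirr : Irreducible hhat) :
    (IsGeneralisedAPolynomial f ↔
      (∃ b : δ.centralConstants,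
        f = h ∧ h = t δ ^ p - const δ a * t δ - const δ (b + c) ∧
        ∀ α : D, V δ p α - a * α - (b + c) ≠ 0) ∨
      (∃ b : δ.centralConstants,
        h = t δ ^ p - const δ a * t δ - const δ (b + c) ∧ m ≤ p ∧
        ∃ (v : Fin m → D) (α : D),
          (∀ i, v i ≠ 0) ∧ (∀ i : Fin m, (i : ℕ) + 1 = m → v i = 1) ∧
          f = (List.ofFn fun i => t δ - const δ (Omega δ (v i) α)).prod ∧
          V δ p α - a * α - (b + c) = 0)) ∧
    (∀ b : δ.centralConstants,
      f = h → h = t δ ^ p - const δ a * t δ - const δ (b + c) →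
      (∀ α : D, V δ p α - a * α - (b + c) ≠ 0) → Irreducible f) := by
  have hp : p.Prime := Fact.out
  have hz := isMinimalCentral_artinSchreier hg hc hδc
  have hδp (x : D) : δ^[p] x = a * δ^[1] x + (c * x - x * c) :=
    sub_eq_iff_eq_add'.mp ((RingDer.polyApply_X_pow_sub_C_mul_X ..).symm.trans (hc x))
  have := RingDer.finite_centralConstants hp.one_lt hδp
  subst hm
  have hiff := hh.isGeneralisedAPolynomial_iff hirr hm1 fun b => by
    rw [aeval_t_sub_const_sub_algebraMap]
    exact hz b
  simp only [aeval_t_sub_const_sub_algebraMap] at hiff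
  refine ⟨hiff.trans ⟨?_, ?_⟩, ?_⟩
  · rintro ⟨b, rfl⟩
    exact (eq_or_exists_eq_prod_of_artinSchreier_mem_span (hz b) hf hm1 hh.mem_span).imp
      (fun ⟨hfh, hroot⟩ => ⟨b, hfh, rfl, hroot⟩) fun hprod => ⟨b, rfl, hprod⟩
  · rintro (⟨b, -, hb, -⟩ | ⟨b, hb, -⟩) <;> exact ⟨b, hb⟩
  · rintro b rfl hb hroot
    obtain rfl : f = artinSchreier δ p a (b + c) := hb
    have hdeg := natDegree_artinSchreier (δ := δ) hp.one_lt a (b + c)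
    exact (hz b).irreducible_of_forall_notMem_span (hdeg.symm ▸ hp)
      fun α => artinSchreier_mem_span_iff.not.mpr (hroot α)
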